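/- Let $\mathcal K$ be a number field with ring of integers $\mathcal O$, let $\mathbb A(\mathcal K)$ be its ring of full adeles, and for a place $v$ of $\mathcal K$ let $\mathcal K_v$ be the completion of $\mathcal K$ at $v$, with ring of integers $\mathcal O_v$ if $v$ is finite. For a prime $p$ let $\chi_p(x)=\exp(2\pi i\lambda_p(x))$ for $x\in\mathbb Q_p$, where $\lambda_p(x)\in\mathbb Z[1/p]$ satisfies $x-\lambda_p(x)\in\mathbb Z_p$, and let $\chi_\infty(x)=\exp(-2\pi i x)$ for $x\in\mathbb Q_\infty=\mathbb R$. Put $\chi_{\mathbb A(\mathbb Q)}(x)=\prod_{p\le\infty}\chi_p(x_p)$ for $x\in\mathbb A(\mathbb Q)$, put $\operatorname{Tr}(a)=\bigl(\sum_{v\mid p}\operatorname{Tr}_{\mathcal K_v/\mathbb Q_p}(a_v)\bigr)_{p\le\infty}\in\mathbb A(\mathbb Q)$ for $a\in\mathbb A(\mathcal K)$, and let $\langle a,b\rangle=\chi_{\mathbb A(\mathbb Q)}(\operatorname{Tr}(ab))$ be the canonical pairing of $\mathbb A(\mathcal K)$ with itself. For a finite place $v\mid p$ let $$\mathfrak D_v^{-1}=\{b\in\mathcal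 K_v : \operatorname{Tr}_{\mathcal K_v/\mathbb Q_p}(ab)\in\mathbb Z_p\text{ for all }a\in\mathcal O_v\}.$$ Then the product $\mathcal D^{-1}=\prod_{v\nmid\infty}\mathfrak D_v^{-1}$, with its product topology, is embedded homeomorphically in $\mathbb A(\mathcal K)$ by attaching zero components at the infinite places; that is, it is identified, as a topological group, with the subgroup $\mathcal D^{-1}\times\prod_{v\mid\infty}\{0\}$ of all adeles $b$ with $b_v\in\mathfrak D_v^{-1}$ for every finite $v$ and $b_v=0$ for every infinite $v$. Moreover, the canonical pairing induces an isomorphism of topological groups of the Pontryagin dual of the discrete group $\mathcal K/\mathcal O$ onto $\mathcal D^{-1}\times\prod_{v\mid\infty}\{0\}$: the character $\chi$ of $\mathcal K/\mathcal O$ corresponds to the unique $b\in\mathcal D^{-1}\times\prod_{v\mid\infty}\{0\}$ with $$\chi(k+\mathcal O)=\langle k,b\rangle\qquad\text{for all }k\in\mathcal K .$$ -/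

import Mathlib

open NumberField IsDedekindDomain

noncomputable section

namespace AdelicDuality

instance factPrimePrimes (p : Nat.Primes) : Fact p.1.Prime := ⟨p.2⟩

/-! ### The standard characters of the completions of `ℚ` -/

theorem exists_padic_principalPart (p : ℕ) [Fact p.Prime] (x : ℚ_[p]) :
    ∃ r : ℚ, (∃ (m : ℤ) (n : ℕ), r = m / (p : ℚ) ^ n) ∧ x - (r : ℚ_[p]) ∈ PadicInt.subring p := by
  have hp : (p : ℚ_[p]) ≠ 0 := by
    exact_mod_cast (Fact.out : p.Prime).ne_zero
  obtain ⟨n, hn⟩ : ∃ n : ℕ, ‖(p : ℚ_[p]) ^ n * x‖ ≤ 1 := by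
    have hlim : Filter.Tendsto (fun n : ℕ => ‖(p : ℚ_[p])‖ ^ n * ‖x‖) Filter.atTop
        (nhds (0 * ‖x‖)) :=
      (tendsto_pow_atTop_nhds_zero_of_lt_one (norm_nonneg _) Padic.norm_p_lt_one).mul_const _
    rw [zero_mul] at hlim
    obtain ⟨n, hn⟩ := (hlim.eventually (ge_mem_nhds zero_lt_one)).exists
    exact ⟨n, by simpa [norm_mul, norm_pow] using hn⟩
  set y : ℤ_[p] := ⟨(p : ℚ_[p]) ^ n * x, hn⟩
  obtain ⟨c, hc⟩ := Ideal.mem_span_singleton.mp (PadicInt.appr_spec n y)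
  refine ⟨(y.appr n : ℤ) / (p : ℚ) ^ n, ⟨_, n, rfl⟩, ?_⟩
  have h1 : (p : ℚ_[p]) ^ n * x - (y.appr n : ℚ_[p]) = (p : ℚ_[p]) ^ n * (c : ℚ_[p]) := by
    have := congrArg (fun z : ℤ_[p] => (z : ℚ_[p])) hc
    simp only [PadicInt.coe_sub, PadicInt.coe_natCast, PadicInt.coe_mul, PadicInt.coe_pow] at this
    exact this
  have h2 : x - (((y.appr n : ℤ) / (p : ℚ) ^ n : ℚ) : ℚ_[p]) = (c : ℚ_[p]) := by
    push_cast
    have hpn : (p : ℚ_[p]) ^ n ≠ 0 := pow_ne_zero _ hp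
    field_simp
    linear_combination h1
  rw [h2]
  exact c.2

/-- A rational number `λ_p(x) ∈ ℤ[1/p]` with `x - λ_p(x) ∈ ℤ_p`; it is unique modulo `ℤ`. -/
def principalPart (p : ℕ) [Fact p.Prime] (x : ℚ_[p]) : ℚ :=
  (exists_padic_principalPart p x).choose

/-- The character `χ_p(x) = exp(2πi λ_p(x))` of `ℚ_p`. -/
def padicChar (p : ℕ) [Fact p.Prime] (x : ℚ_[p]) : Circle :=
  Circle.exp (2 * Real.pi * (principalPart p x : ℝ))

/-- The character `χ_∞(x) = exp(-2πi x)` of `ℝ`. -/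
def realChar (x : ℝ) : Circle :=
  Circle.exp (-(2 * Real.pi * x))

/-- The character `χ_{𝔸(ℚ)}(x) = ∏_p χ_p(x_p)`, the product being over all places of `ℚ`, for
`x = (x_∞, (x_p)_p)`. If `x` is an adele, then `x_p ∈ ℤ_p` for almost all `p`, so that only
finitely many factors differ from `1`. -/
def adelicChar (x : ℝ × (∀ p : Nat.Primes, ℚ_[p.1])) : Circle :=
  realChar x.1 * ∏ᶠ p : Nat.Primes, padicChar p.1 (x.2 p)

/-! ### The local extensions `K_v / ℚ_p` and `K_v / ℝ` and their traces -/

variable {K : Type*} [Field K] [NumberField K]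

/-- The canonical embedding of `ℝ` in the completion of `K` at an infinite place. -/
def realToCompletion (v : InfinitePlace K) : ℝ →+* v.Completion :=
  open Classical in
  if hv : v.IsReal then
    (InfinitePlace.Completion.ringEquivRealOfIsReal hv).symm.toRingHom
  else
    (InfinitePlace.Completion.ringEquivComplexOfIsComplex
      (InfinitePlace.not_isReal_iff_isComplex.1 hv)).symm.toRingHom.comp Complex.ofRealHom

/-- The trace `Tr_{K_v/ℝ}` at an infinite place `v`. -/
def infiniteTrace (v : InfinitePlace K) (x : v.Completion) : ℝ :=
  letI : Algebra ℝ v.Completion := (realToCompletion v).toAlgebra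
  Algebra.trace ℝ v.Completion x

theorem norm_ratCast_le_one (v : HeightOneSpectrum (𝓞 K)) (p : ℕ) [Fact p.Prime]
    (hv : (p : 𝓞 K) ∈ v.asIdeal) (q : ℚ) (hq : ‖(q : ℚ_[p])‖ ≤ 1) :
    ‖FinitePlace.embedding v (q : K)‖ ≤ 1 := by
  have hden : ¬ p ∣ q.den := by
    intro h
    have hnum : ¬ (p : ℤ) ∣ q.num := by
      intro h'
      have := Nat.dvd_gcd (Int.natCast_dvd.mp h') h
      rw [q.reduced] at this
      exact (Fact.out : p.Prime).one_lt.ne' (Nat.dvd_one.mp this)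
    have hn1 : ‖((q.num : ℤ) : ℚ_[p])‖ = 1 := by
      refine le_antisymm (Padic.norm_int_le_one _) (not_lt.mp fun hlt => hnum ?_)
      exact (Padic.norm_intCast_lt_one_iff).mp hlt
    have hd1 : ‖((q.den : ℤ) : ℚ_[p])‖ < 1 :=
      (Padic.norm_intCast_lt_one_iff).mpr (by exact_mod_cast h)
    have hmul : (q : ℚ_[p]) * ((q.den : ℤ) : ℚ_[p]) = ((q.num : ℤ) : ℚ_[p]) := by
      have := Rat.mul_den_eq_num q
      exact_mod_cast congrArg (fun r : ℚ => (r : ℚ_[p])) this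
    have := congrArg norm hmul
    rw [norm_mul, hn1] at this
    nlinarith [norm_nonneg (q : ℚ_[p]), norm_nonneg ((q.den : ℤ) : ℚ_[p])]
  have hden' : ((q.den : ℕ) : 𝓞 K) ∉ v.asIdeal := by
    intro h
    have hco : IsCoprime (p : ℤ) (q.den : ℤ) :=
      Nat.isCoprime_iff_coprime.mpr (((Fact.out : p.Prime).coprime_iff_not_dvd).mpr hden)
    obtain ⟨a, b, hab⟩ := hco
    apply v.isPrime.ne_top
    rw [Ideal.eq_top_iff_one]
    have : (1 : 𝓞 K) = (a : 𝓞 K) * (p : 𝓞 K) + (b : 𝓞 K) * ((q.den : ℕ) : 𝓞 K) := by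
      exact_mod_cast (congrArg (fun z : ℤ => (z : 𝓞 K)) hab).symm
    rw [this]
    exact v.asIdeal.add_mem (v.asIdeal.mul_mem_left _ hv) (v.asIdeal.mul_mem_left _ h)
  have hd : ‖FinitePlace.embedding v (algebraMap (𝓞 K) K ((q.den : ℕ) : 𝓞 K))‖ = 1 :=
    (FinitePlace.norm_eq_one_iff_notMem K v _).mpr hden'
  have hn : ‖FinitePlace.embedding v (algebraMap (𝓞 K) K ((q.num : ℤ) : 𝓞 K))‖ ≤ 1 :=
    FinitePlace.norm_le_one K v _
  have hmul : (q : K) * algebraMap (𝓞 K) K ((q.den : ℕ) : 𝓞 K)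
      = algebraMap (𝓞 K) K ((q.num : ℤ) : 𝓞 K) := by
    have := Rat.mul_den_eq_num q
    simp only [map_natCast, map_intCast]
    exact_mod_cast congrArg (fun r : ℚ => (r : K)) this
  have := congrArg (fun z => ‖FinitePlace.embedding v z‖) hmul
  simp only [map_mul, norm_mul] at this
  rw [hd, mul_one] at this
  rw [this]
  exact hn

/-- The embedding `ℚ → K_v`, where `ℚ` carries the `p`-adic topology. -/
def ratToCompletion (v : HeightOneSpectrum (𝓞 K)) (p : ℕ) [Fact p.Prime] :
    WithVal (Rat.padicValuation p) →+* v.adicCompletion K :=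
  (FinitePlace.embedding v).comp
    ((Rat.castHom K).comp (WithVal.equiv (Rat.padicValuation p)).toRingHom)

theorem continuous_ratToCompletion (v : HeightOneSpectrum (𝓞 K)) (p : ℕ) [Fact p.Prime]
    (hv : (p : 𝓞 K) ∈ v.asIdeal) : Continuous (ratToCompletion v p) := by
  refine continuous_of_continuousAt_zero (ratToCompletion v p) ?_
  rw [ContinuousAt, map_zero, Padic.isUniformInducing_cast_withVal.isInducing.nhds_eq_comap,
    map_zero, Metric.tendsto_nhds]
  intro ε hε
  have hpv : ‖FinitePlace.embedding v (algebraMap (𝓞 K) K (p : 𝓞 K))‖ < 1 :=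
    (FinitePlace.norm_lt_one_iff_mem K v _).mpr hv
  obtain ⟨n, hn⟩ := exists_pow_lt_of_lt_one hε hpv
  have hp0 : (p : ℚ) ≠ 0 := by exact_mod_cast (Fact.out : p.Prime).ne_zero
  have hpn : 0 < ‖(p : ℚ_[p]) ^ n‖ := by
    rw [norm_pos_iff]
    exact pow_ne_zero _ (by exact_mod_cast (Fact.out : p.Prime).ne_zero)
  refine Filter.mem_comap.mpr ⟨Metric.ball 0 ‖(p : ℚ_[p]) ^ n‖, Metric.ball_mem_nhds _ hpn, ?_⟩
  intro x hx
  set q : ℚ := WithVal.equiv (Rat.padicValuation p) x with hqx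
  have hq : ‖(q : ℚ_[p])‖ < ‖(p : ℚ_[p]) ^ n‖ := by
    simpa [hqx] using hx
  have hr : ‖((q / (p : ℚ) ^ n : ℚ) : ℚ_[p])‖ ≤ 1 := by
    push_cast
    rw [norm_div, div_le_one hpn]
    exact hq.le
  have hr' := norm_ratCast_le_one v p hv _ hr
  have hqr : (q : K) = algebraMap (𝓞 K) K (p : 𝓞 K) ^ n * ((q / (p : ℚ) ^ n : ℚ) : K) := by
    have h : q = (p : ℚ) ^ n * (q / (p : ℚ) ^ n) := by field_simp
    rw [map_natCast]
    exact_mod_cast congrArg (fun r : ℚ => (r : K)) h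
  have hval : ratToCompletion v p x = FinitePlace.embedding v (q : K) := rfl
  change dist (ratToCompletion v p x) 0 < ε
  rw [dist_zero_right, hval, hqr, map_mul, map_pow, norm_mul, norm_pow]
  exact (mul_le_of_le_one_right (by positivity) hr').trans_lt hn

/-- The canonical embedding `ℚ_p → K_v` for a finite place `v` above `p`: the extension by
continuity of the embedding `ℚ → K_v`. -/
def padicToCompletion (v : HeightOneSpectrum (𝓞 K)) (p : ℕ) [Fact p.Prime]
    (hv : (p : 𝓞 K) ∈ v.asIdeal) : ℚ_[p] →+* v.adicCompletion K :=
  (UniformSpace.Completion.extensionHom (ratToCompletion v p)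
    (continuous_ratToCompletion v p hv)).comp Padic.withValRingEquiv.symm.toRingHom

/-- The trace `Tr_{K_v/ℚ_p}` at a finite place `v` above `p`. -/
def finiteTrace (v : HeightOneSpectrum (𝓞 K)) (p : ℕ) [Fact p.Prime]
    (hv : (p : 𝓞 K) ∈ v.asIdeal) (x : v.adicCompletion K) : ℚ_[p] :=
  letI : Algebra ℚ_[p] (v.adicCompletion K) := (padicToCompletion v p hv).toAlgebra
  Algebra.trace ℚ_[p] (v.adicCompletion K) x

variable (K) in
/-- The trace `Tr_{𝔸(K)/𝔸(ℚ)}`: its component at a place `p ≤ ∞` of `ℚ` is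
`∑_{v ∣ p} Tr_{K_v/ℚ_p}(a_v)`, where `ℚ_∞ = ℝ`. -/
def adelicTrace (a : AdeleRing (𝓞 K) K) : ℝ × (∀ p : Nat.Primes, ℚ_[p.1]) :=
  (∑ v : InfinitePlace K, infiniteTrace v (a.1 v),
    fun p => ∑ᶠ v : {v : HeightOneSpectrum (𝓞 K) // (p.1 : 𝓞 K) ∈ v.asIdeal},
      finiteTrace v.1 p.1 v.2 (a.2 v.1))

variable (K) in
/-- The canonical pairing `⟨a, b⟩ = χ_{𝔸(ℚ)}(Tr_{𝔸(K)/𝔸(ℚ)}(ab))` of `𝔸(K)` with itself. -/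
def adelicPairing (a b : AdeleRing (𝓞 K) K) : Circle :=
  adelicChar (adelicTrace K (a * b))

/-! ### The inverse different -/

/-- The local inverse different
`𝔇_v⁻¹ = {b ∈ K_v | Tr_{K_v/ℚ_p}(ab) ∈ ℤ_p for all a ∈ 𝓞_v}`, where `p` is the prime below `v`. -/
def localInverseDifferent (v : HeightOneSpectrum (𝓞 K)) : AddSubgroup (v.adicCompletion K) where
  carrier := {b | ∀ (p : Nat.Primes) (hv : (p.1 : 𝓞 K) ∈ v.asIdeal),
    ∀ a ∈ v.adicCompletionIntegers K, finiteTrace v p.1 hv (a * b) ∈ PadicInt.subring p.1}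
  zero_mem' := fun p hv a _ => by simp [finiteTrace]
  add_mem' := fun {b c} hb hc p hv a ha => by
    have := (PadicInt.subring p.1).add_mem (hb p hv a ha) (hc p hv a ha)
    simpa [finiteTrace, mul_add] using this
  neg_mem' := fun {b} hb p hv a ha => by
    have := (PadicInt.subring p.1).neg_mem (hb p hv a ha)
    simpa [finiteTrace] using this

variable (K) in
/-- The adelic inverse different `𝒟⁻¹ × ∏_{v ∣ ∞} {0}`, as a subgroup of the full adeles. -/
def adelicInverseDifferent : AddSubgroup (AdeleRing (𝓞 K) K) where
  carrier := {b | b.1 = 0 ∧ ∀ v : HeightOneSpectrum (𝓞 K), b.2 v ∈ localInverseDifferent v}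
  zero_mem' := ⟨rfl, fun v => (localInverseDifferent v).zero_mem⟩
  add_mem' := fun hb hc =>
    ⟨(congrArg₂ (· + ·) hb.1 hc.1).trans (add_zero 0),
      fun v => (localInverseDifferent v).add_mem (hb.2 v) (hc.2 v)⟩
  neg_mem' := fun hb =>
    ⟨(congrArg (- ·) hb.1).trans neg_zero, fun v => (localInverseDifferent v).neg_mem (hb.2 v)⟩

/-! ### The discrete group `K / 𝓞` -/

variable (K) in
/-- The ring of integers as an additive subgroup of `K`. -/
def integersAddSubgroup : AddSubgroup K := (algebraMap (𝓞 K) K).range.toAddSubgroup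

variable (K) in
/-- The quotient group `K / 𝓞`. -/
def FieldModIntegers : Type _ := K ⧸ integersAddSubgroup K

instance : AddCommGroup (FieldModIntegers K) :=
  inferInstanceAs (AddCommGroup (K ⧸ integersAddSubgroup K))

/-- `K / 𝓞` is a discrete group. -/
instance : TopologicalSpace (FieldModIntegers K) := ⊥

instance : DiscreteTopology (FieldModIntegers K) := ⟨rfl⟩

/-- The class `k + 𝓞`. -/
def toFieldModIntegers (k : K) : FieldModIntegers K :=
  QuotientAddGroup.mk (s := integersAddSubgroup K) k

end AdelicDuality

end

/-! Fix an integral basis `ω_i` of `K` and its dual basis `ω_i*` for the trace form. For each prime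
`p` the `ω_i` form a `ℚ_p`-basis of `∏_{v ∣ p} K_v`, and `∏_{v ∣ p} 𝓞_v` is their `ℤ_p`-span
(`exists_padicInt_combination`, `linearIndependent_localProduct`). Global and local traces agree on
`K`, so `∏_{v ∣ p} 𝔇_v⁻¹` is the `ℤ_p`-span of the `ω_i*`, and `b ↦ Tr(ω_i b)_p` identifies `𝒟⁻¹`
with `(∏_p ℤ_p)^n`.

The basis `ω_i` also identifies `K / 𝓞` with `(ℚ / ℤ)^n`. Since the infinite components of `b`
vanish, the pairing becomes the product over `i` of the pairings `(q, c) ↦ ∏_p χ_p(q c_p)` of `ℚ /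
ℤ` with `∏_p ℤ_p` (`adelicPairing_algebraMap`). Everything thus reduces to the duality between these
two groups: `padicProductChar_injective` and `exists_padicProductChar_eq`.

For the topology, a common denominator of the `ω_i*` carries `∏_v 𝔇_v⁻¹` into `∏_v 𝓞_v`, on which
the adelic topology is the product topology. Hence the coordinates parametrize `𝒟⁻¹` continuously by
a compact space, and a continuous bijection from a compact space onto the Hausdorff dual is a
homeomorphism. -/

namespace AdelicDuality

variable {K : Type*} [Field K] [NumberField K]

/-! ### Norm and valuation at a finite place -/

theorem norm_le_norm_iff (v : HeightOneSpectrum (𝓞 K)) (x y : v.adicCompletion K) :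
    ‖x‖ ≤ ‖y‖ ↔ Valued.v x ≤ Valued.v y := by
  rw [FinitePlace.norm_def, FinitePlace.norm_def, NNReal.coe_le_coe]
  exact (WithZeroMulInt.toNNReal_strictMono
    (HeightOneSpectrum.one_lt_absNorm_nnreal v)).le_iff_le

theorem mem_adicCompletionIntegers_iff_norm_le_one (v : HeightOneSpectrum (𝓞 K))
    (x : v.adicCompletion K) : x ∈ v.adicCompletionIntegers K ↔ ‖x‖ ≤ 1 := by
  rw [HeightOneSpectrum.mem_adicCompletionIntegers, ← norm_one (α := v.adicCompletion K),
    norm_le_norm_iff, map_one]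

theorem algebraMap_integer_mem (v : HeightOneSpectrum (𝓞 K)) (x : 𝓞 K) :
    algebraMap K (v.adicCompletion K) x ∈ v.adicCompletionIntegers K :=
  (mem_adicCompletionIntegers_iff_norm_le_one v _).2 (FinitePlace.norm_le_one K v x)

theorem isClosed_adicCompletionIntegers (v : HeightOneSpectrum (𝓞 K)) :
    IsClosed (v.adicCompletionIntegers K : Set (v.adicCompletion K)) := by
  have h : (v.adicCompletionIntegers K : Set (v.adicCompletion K)) = {x | ‖x‖ ≤ 1} := by
    ext x
    exact mem_adicCompletionIntegers_iff_norm_le_one v x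
  rw [h]
  exact isClosed_le continuous_norm continuous_const

/-! ### The places above a rational prime -/

variable (K) in
/-- The finite places of `K` above the prime number `p`. -/
abbrev PlacesOver (p : ℕ) : Type _ := {v : HeightOneSpectrum (𝓞 K) // (p : 𝓞 K) ∈ v.asIdeal}

noncomputable instance (p : ℕ) [Fact p.Prime] (w : PlacesOver K p) :
    Algebra ℚ_[p] (w.1.adicCompletion K) :=
  (padicToCompletion w.1 p w.2).toAlgebra

theorem continuous_padicToCompletion (v : HeightOneSpectrum (𝓞 K)) (p : ℕ) [Fact p.Prime]
    (hv : (p : 𝓞 K) ∈ v.asIdeal) : Continuous (padicToCompletion v p hv) :=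
  UniformSpace.Completion.continuous_extension.comp
    (Padic.withValUniformEquiv (p := p)).symm.continuous

instance (p : ℕ) [Fact p.Prime] (w : PlacesOver K p) :
    ContinuousSMul ℚ_[p] (w.1.adicCompletion K) where
  continuous_smul := by
    simp only [Algebra.smul_def]
    exact ((continuous_padicToCompletion w.1 p w.2).comp continuous_fst).mul continuous_snd

/-- The natural numbers are dense in `ℤ_p`, and the local ring of integers is closed. -/
theorem padicToCompletion_mem (v : HeightOneSpectrum (𝓞 K)) (p : ℕ) [Fact p.Prime]
    (hv : (p : 𝓞 K) ∈ v.asIdeal) (z : ℤ_[p]) :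
    padicToCompletion v p hv z ∈ v.adicCompletionIntegers K := by
  induction z using PadicInt.denseRange_natCast.induction_on with
  | hp =>
    exact (isClosed_adicCompletionIntegers v).preimage
      ((continuous_padicToCompletion v p hv).comp continuous_subtype_val)
  | ih n =>
    rw [PadicInt.coe_natCast, map_natCast]
    exact natCast_mem _ n

theorem finite_placesOver (p : ℕ) [Fact p.Prime] : Finite (PlacesOver K p) := by
  have hp : (p : 𝓞 K) ≠ 0 := by exact_mod_cast (Fact.out : p.Prime).ne_zero
  have h0 : Ideal.span {(p : 𝓞 K)} ≠ 0 := by simpa using hp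
  refine Set.Finite.to_subtype ((Ideal.finite_factors h0).subset fun v hv => ?_)
  exact Ideal.dvd_span_singleton.2 hv

instance (p : ℕ) [Fact p.Prime] : Finite (PlacesOver K p) := finite_placesOver p

noncomputable instance (p : ℕ) [Fact p.Prime] : Fintype (PlacesOver K p) := Fintype.ofFinite _

theorem eq_of_mem_asIdeal (v : HeightOneSpectrum (𝓞 K)) {p q : ℕ} (hp : p.Prime) (hq : q.Prime)
    (hpv : (p : 𝓞 K) ∈ v.asIdeal) (hqv : (q : 𝓞 K) ∈ v.asIdeal) : p = q := by
  by_contra hne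
  obtain ⟨a, b, hab⟩ := Nat.isCoprime_iff_coprime.mpr ((Nat.coprime_primes hp hq).2 hne)
  refine v.isPrime.ne_top ((Ideal.eq_top_iff_one _).2 ?_)
  have : (1 : 𝓞 K) = (a : 𝓞 K) * (p : 𝓞 K) + (b : 𝓞 K) * (q : 𝓞 K) := by
    exact_mod_cast (congrArg (fun z : ℤ => (z : 𝓞 K)) hab).symm
  rw [this]
  exact v.asIdeal.add_mem (v.asIdeal.mul_mem_left _ hpv) (v.asIdeal.mul_mem_left _ hqv)

theorem exists_prime_mem_asIdeal (v : HeightOneSpectrum (𝓞 K)) :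
    ∃ p : Nat.Primes, (p.1 : 𝓞 K) ∈ v.asIdeal := by
  have hn : (Ideal.absNorm v.asIdeal) ≠ 0 := by
    rw [Ne, Ideal.absNorm_eq_zero_iff]
    exact v.ne_bot
  have hmem : ((Ideal.absNorm v.asIdeal : ℕ) : 𝓞 K) ∈ v.asIdeal := Ideal.absNorm_mem _
  rw [← Nat.prod_primeFactorsList hn, Nat.cast_list_prod] at hmem
  obtain ⟨x, hx, hxv⟩ := (v.isPrime.multiset_prod_mem_iff_exists_mem
    ((Ideal.absNorm v.asIdeal).primeFactorsList.map (Nat.cast : ℕ → 𝓞 K))).1 (by simpa using hmem)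
  simp only [Multiset.mem_coe, List.mem_map] at hx
  obtain ⟨p, hp, rfl⟩ := hx
  exact ⟨⟨p, Nat.prime_of_mem_primeFactorsList hp⟩, hxv⟩

/-! ### Approximation -/

/-- Density of `K` gives an approximation that is integral at `v` but perhaps not elsewhere; it is
then replaced by a global integer close to it at `v`. -/
theorem exists_integer_norm_sub_le (v : HeightOneSpectrum (𝓞 K)) {a : v.adicCompletion K}
    (ha : a ∈ v.adicCompletionIntegers K) {c : K} (hc : c ≠ 0) :
    ∃ x : 𝓞 K, Valued.v (a - algebraMap K (v.adicCompletion K) x) ≤ v.valuation K c := by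
  have hvc : v.valuation K c ≠ 0 := (Valuation.ne_zero_iff _).2 hc
  -- The bound `1` keeps the approximation `k` integral at `v`; the bound `‖c‖` is the required
  -- precision.
  have hc0 : 0 < min 1 ‖algebraMap K (v.adicCompletion K) c‖ :=
    lt_min one_pos (norm_pos_iff.2 ((map_ne_zero _).2 hc))
  obtain ⟨k, hk⟩ := (v.denseRange_algebraMap K).exists_dist_lt a hc0
  rw [dist_eq_norm, lt_min_iff] at hk
  have h1 : Valued.v (a - algebraMap K (v.adicCompletion K) k) ≤ v.valuation K c := by
    rw [← HeightOneSpectrum.valuedAdicCompletion_eq_valuation']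
    exact (norm_le_norm_iff v _ _).1 hk.2.le
  have h2 : v.valuation K k ≤ 1 := by
    rw [← HeightOneSpectrum.valuedAdicCompletion_eq_valuation']
    have h3 := sub_mem ha ((mem_adicCompletionIntegers_iff_norm_le_one v _).2 hk.1.le)
    rw [sub_sub_cancel] at h3
    exact h3
  obtain ⟨x, hx⟩ := v.exists_valuation_sub_lt_of_integer h2 (Units.mk0 _ hvc)
  refine ⟨x, ?_⟩
  have h4 : a - algebraMap K (v.adicCompletion K) x = (a - algebraMap K (v.adicCompletion K) k) -
      algebraMap K (v.adicCompletion K) ((x : K) - k) := by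
    rw [map_sub]; ring
  rw [h4]
  refine (Valuation.map_sub _ _ _).trans (max_le h1 ?_)
  exact (HeightOneSpectrum.valuedAdicCompletion_eq_valuation' v _).trans_le hx.le

theorem exists_integer_sub_mem_pow (p : ℕ) [Fact p.Prime] (y : PlacesOver K p → 𝓞 K)
    (m : PlacesOver K p → ℕ) : ∃ x : 𝓞 K, ∀ w, x - y w ∈ w.1.asIdeal ^ m w := by
  obtain ⟨x, hx⟩ := IsDedekindDomain.exists_forall_sub_mem_ideal (s := Finset.univ)
    (fun w : PlacesOver K p => w.1.asIdeal) m (fun w _ => w.1.prime)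
    (fun w _ w' _ h h' => h (Subtype.ext (HeightOneSpectrum.ext h'))) (fun w => y w.1)
  exact ⟨x, fun w => hx w (Finset.mem_univ _)⟩

/-- Integers of `K` approximate tuples of local integers at the places above `p`. -/
theorem exists_integer_approx (p : ℕ) [Fact p.Prime]
    (a : ∀ w : PlacesOver K p, w.1.adicCompletion K)
    (ha : ∀ w, a w ∈ w.1.adicCompletionIntegers K) {c : 𝓞 K} (hc : c ≠ 0) :
    ∃ x : 𝓞 K, ∀ w : PlacesOver K p,
      ‖a w - algebraMap K (w.1.adicCompletion K) x‖ ≤ ‖algebraMap K (w.1.adicCompletion K) c‖ := by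
  have hcK : (c : K) ≠ 0 := by simpa using hc
  choose y hy using fun w : PlacesOver K p => exists_integer_norm_sub_le w.1 (ha w) hcK
  -- With the exact exponent of `w` in `(c)`, membership in the power of the ideal says that the
  -- valuation is at most that of `c`.
  obtain ⟨x, hx⟩ := exists_integer_sub_mem_pow p y fun w =>
    multiplicity w.1.asIdeal (Ideal.span {c})
  refine ⟨x, fun w => ?_⟩
  have h1 := hx w
  rw [← HeightOneSpectrum.intValuation_le_pow_iff_mem,
    ← w.1.intValuation_eq_exp_neg_multiplicity hc, ← w.1.valuation_of_algebraMap (K := K),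
    ← w.1.valuation_of_algebraMap (K := K)] at h1
  have h4 : a w - algebraMap K (w.1.adicCompletion K) x =
      (a w - algebraMap K (w.1.adicCompletion K) (y w)) -
      algebraMap K (w.1.adicCompletion K) (algebraMap (𝓞 K) K (x - y w)) := by
    rw [map_sub, map_sub]; ring
  have h5 (k : K) : Valued.v (algebraMap K (w.1.adicCompletion K) k) = w.1.valuation K k :=
    HeightOneSpectrum.valuedAdicCompletion_eq_valuation' w.1 _
  rw [norm_le_norm_iff, h4, h5]
  refine (Valuation.map_sub _ _ _).trans (max_le (hy w) ?_)
  rw [h5]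
  exact h1

/-! ### The product of the completions above a rational prime -/

variable (K) in
/-- The product of the completions of `K` at the places above `p`. -/
abbrev LocalProduct (p : ℕ) : Type _ := ∀ w : PlacesOver K p, w.1.adicCompletion K

variable (K) in
/-- The index type of the integral basis of `K`. -/
abbrev BasisIndex : Type _ := Module.Free.ChooseBasisIndex ℤ (𝓞 K)

theorem algebraMap_localProduct_apply (p : ℕ) (k : K) (w : PlacesOver K p) :
    algebraMap K (LocalProduct K p) k w = algebraMap K (w.1.adicCompletion K) k := rfl

theorem ratCast_smul_localProduct (p : ℕ) [Fact p.Prime] (q : ℚ) (x : LocalProduct K p) :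
    (q : ℚ_[p]) • x = algebraMap K (LocalProduct K p) q * x := by
  funext w
  rw [Pi.smul_apply, Algebra.smul_def, Pi.mul_apply, algebraMap_localProduct_apply, map_ratCast,
    map_ratCast]

theorem intCast_smul_localProduct (p : ℕ) [Fact p.Prime] (m : ℤ) (x : LocalProduct K p) :
    (m : ℚ_[p]) • x = algebraMap K (LocalProduct K p) m * x := by
  simpa only [Rat.cast_intCast] using ratCast_smul_localProduct p (m : ℚ) x

theorem algebraMap_eq_sum_repr (x : 𝓞 K) :
    (x : K) = ∑ i, (((RingOfIntegers.basis K).repr x i : ℤ) : K) * integralBasis K i := by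
  conv_lhs => rw [← (RingOfIntegers.basis K).sum_repr x]
  simp [map_sum, integralBasis_apply]

theorem algebraMap_localProduct_eq_sum (p : ℕ) [Fact p.Prime] (x : 𝓞 K) :
    algebraMap K (LocalProduct K p) x = ∑ i, (((RingOfIntegers.basis K).repr x i : ℤ) : ℚ_[p]) •
      algebraMap K (LocalProduct K p) (integralBasis K i) := by
  rw [algebraMap_eq_sum_repr, map_sum]
  simp_rw [map_mul, intCast_smul_localProduct]

theorem norm_algebraMap_prime_lt_one (p : ℕ) (w : PlacesOver K p) :
    ‖algebraMap K (w.1.adicCompletion K) (p : 𝓞 K)‖ < 1 :=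
  (FinitePlace.norm_lt_one_iff_mem K w.1 _).2 w.2

/-- The product of the local rings of integers above `p` is spanned over `ℤ_p` by an integral
basis of `K`. -/
theorem exists_padicInt_combination (p : ℕ) [Fact p.Prime] (a : LocalProduct K p)
    (ha : ∀ w, a w ∈ w.1.adicCompletionIntegers K) :
    ∃ c : BasisIndex K → ℤ_[p],
      a = ∑ i, (c i : ℚ_[p]) • algebraMap K (LocalProduct K p) (integralBasis K i) := by
  let f : (BasisIndex K → ℤ_[p]) → LocalProduct K p :=
    fun c => ∑ i, (c i : ℚ_[p]) • algebraMap K (LocalProduct K p) (integralBasis K i)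
  have hf : Continuous f := by
    refine continuous_finsetSum _ fun i _ => ?_
    have h : Continuous fun c : BasisIndex K → ℤ_[p] => (c i : ℚ_[p]) :=
      continuous_subtype_val.comp (continuous_apply i)
    exact h.smul continuous_const
  -- The `ℤ_p`-span is a continuous image of a compact space, hence closed, so density suffices.
  suffices h : a ∈ closure (Set.range f) by
    rw [(isCompact_range hf).isClosed.closure_eq] at h
    obtain ⟨c, hc⟩ := h
    exact ⟨c, hc.symm⟩
  refine Metric.mem_closure_iff.2 fun ε hε => ?_
  have hlim : ∀ w : PlacesOver K p, ∀ᶠ n : ℕ in Filter.atTop,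
      ‖algebraMap K (w.1.adicCompletion K) (p : 𝓞 K)‖ ^ n < ε := fun w =>
    (tendsto_pow_atTop_nhds_zero_of_lt_one (norm_nonneg _)
      (norm_algebraMap_prime_lt_one p w)).eventually (gt_mem_nhds hε)
  obtain ⟨n, hn⟩ := (Filter.eventually_all.2 hlim).exists
  have hp : (p : 𝓞 K) ^ n ≠ 0 := pow_ne_zero _ (by exact_mod_cast (Fact.out : p.Prime).ne_zero)
  obtain ⟨x, hx⟩ := exists_integer_approx p a ha hp
  refine ⟨_, ⟨fun i => (RingOfIntegers.basis K).repr x i, rfl⟩, ?_⟩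
  have hfx : f (fun i => (RingOfIntegers.basis K).repr x i) =
      algebraMap K (LocalProduct K p) x := by
    simp only [f, PadicInt.coe_intCast]
    exact (algebraMap_localProduct_eq_sum p x).symm
  rw [hfx, dist_pi_lt_iff hε]
  intro w
  rw [dist_eq_norm]
  refine (hx w).trans_lt ?_
  simpa using hn w

theorem padicInt_smul_mem (p : ℕ) [Fact p.Prime] (w : PlacesOver K p) (z : ℤ_[p])
    {x : w.1.adicCompletion K} (hx : x ∈ w.1.adicCompletionIntegers K) :
    (z : ℚ_[p]) • x ∈ w.1.adicCompletionIntegers K := by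
  rw [Algebra.smul_def]
  exact mul_mem (padicToCompletion_mem w.1 p w.2 z) hx

theorem sum_smul_integralBasis_mem (p : ℕ) [Fact p.Prime] (c : BasisIndex K → ℤ_[p])
    (w : PlacesOver K p) :
    (∑ i, (c i : ℚ_[p]) • algebraMap K (LocalProduct K p) (integralBasis K i)) w ∈
      w.1.adicCompletionIntegers K := by
  rw [Finset.sum_apply]
  refine sum_mem fun i _ => padicInt_smul_mem p w (c i) ?_
  rw [integralBasis_apply]
  exact algebraMap_integer_mem w.1 _

/-- Integrality of `x / p` is checked place by place: above `p` it is given by `y`, and elsewhere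
`p` is a unit. -/
theorem exists_eq_prime_mul (p : ℕ) [Fact p.Prime] (x : 𝓞 K) (y : LocalProduct K p)
    (hy : ∀ w, y w ∈ w.1.adicCompletionIntegers K)
    (hx : algebraMap K (LocalProduct K p) x = algebraMap K (LocalProduct K p) p * y) :
    ∃ z : 𝓞 K, x = (p : ℤ) • z := by
  have hp0 : (p : K) ≠ 0 := by exact_mod_cast (Fact.out : p.Prime).ne_zero
  have hint : (x : K) / p ∈ (algebraMap (𝓞 K) K).range := by
    refine HeightOneSpectrum.mem_integers_of_valuation_le_one K _ fun v => ?_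
    rw [← HeightOneSpectrum.valuedAdicCompletion_eq_valuation']
    change algebraMap K (v.adicCompletion K) ((x : K) / p) ∈ v.adicCompletionIntegers K
    rw [map_div₀]
    by_cases hv : (p : 𝓞 K) ∈ v.asIdeal
    · have h : algebraMap K (v.adicCompletion K) x =
          algebraMap K (v.adicCompletion K) p * y ⟨v, hv⟩ := congrFun hx ⟨v, hv⟩
      rw [h, mul_div_cancel_left₀ _ ((map_ne_zero _).2 hp0)]
      exact hy ⟨v, hv⟩
    · have h1 : ‖algebraMap K (v.adicCompletion K) (algebraMap (𝓞 K) K (p : 𝓞 K))‖ = 1 :=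
        (FinitePlace.norm_eq_one_iff_notMem K v _).2 hv
      rw [map_natCast] at h1
      rw [mem_adicCompletionIntegers_iff_norm_le_one, norm_div, h1, div_one]
      exact FinitePlace.norm_le_one K v x
  obtain ⟨z, hz⟩ := hint
  refine ⟨z, RingOfIntegers.ext ?_⟩
  have h : (x : K) = p * z := by
    change (x : K) = p * algebraMap (𝓞 K) K z
    rw [hz]
    field_simp
  simpa using h

/-- Replacing the `c i` by integers `m i` congruent to them modulo `p` gives a global integer `x`
that is locally divisible by `p` above `p`. Then `x` is divisible by `p` in `𝓞`, so its coordinates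
`m i` are, and hence the `c i` too. -/
theorem prime_dvd_of_sum_eq_zero (p : ℕ) [Fact p.Prime] (c : BasisIndex K → ℤ_[p])
    (hc : ∑ i, (c i : ℚ_[p]) • algebraMap K (LocalProduct K p) (integralBasis K i) = 0)
    (i : BasisIndex K) : (p : ℤ_[p]) ∣ c i := by
  have happ : ∀ i, ∃ m : ℤ, ∃ d : ℤ_[p], (m : ℤ_[p]) = c i + p * d := fun i => by
    obtain ⟨d, hd⟩ := Ideal.mem_span_singleton.mp (PadicInt.appr_spec 1 (c i))
    refine ⟨(c i).appr 1, -d, ?_⟩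
    rw [pow_one] at hd
    push_cast
    linear_combination -hd
  choose m d hmd using happ
  let x : 𝓞 K := ∑ i, m i • RingOfIntegers.basis K i
  have hrepr (i) : (RingOfIntegers.basis K).repr x i = m i := by
    simp only [x]
    rw [Module.Basis.repr_sum_self]
  have hx : algebraMap K (LocalProduct K p) x = algebraMap K (LocalProduct K p) p *
      ∑ i, (d i : ℚ_[p]) • algebraMap K (LocalProduct K p) (integralBasis K i) := by
    rw [algebraMap_localProduct_eq_sum]
    have h (i) : (((RingOfIntegers.basis K).repr x i : ℤ) : ℚ_[p]) = c i + p * d i := by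
      rw [hrepr]
      exact_mod_cast congrArg (fun z : ℤ_[p] => (z : ℚ_[p])) (hmd i)
    simp_rw [h, add_smul, Finset.sum_add_distrib, hc, zero_add, mul_smul, ← Finset.smul_sum]
    simpa only [Rat.cast_natCast] using ratCast_smul_localProduct p (p : ℚ) _
  obtain ⟨y, hxy⟩ := exists_eq_prime_mul p x _ (sum_smul_integralBasis_mem p d) hx
  have hm : m i = p * (RingOfIntegers.basis K).repr y i := by
    rw [← hrepr, hxy, map_smul, Finsupp.smul_apply, smul_eq_mul]
  have h1 := hmd i
  rw [hm] at h1
  refine ⟨(RingOfIntegers.basis K).repr y i - d i, ?_⟩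
  push_cast at h1
  linear_combination -h1

theorem linearIndependent_localProduct (p : ℕ) [Fact p.Prime] :
    LinearIndependent ℚ_[p]
      fun i => algebraMap K (LocalProduct K p) (integralBasis K i) := by
  rw [Fintype.linearIndependent_iff]
  intro g hg
  by_contra! hne
  obtain ⟨i₀, hi₀⟩ := hne
  -- Dividing by a coefficient of largest norm makes all coefficients integral and one of them equal
  -- to `1`, which `p` cannot divide.
  obtain ⟨j, -, hj⟩ := Finset.exists_max_image Finset.univ (fun i => ‖g i‖) ⟨i₀, Finset.mem_univ _⟩
  have hgj : 0 < ‖g j‖ := (norm_pos_iff.2 hi₀).trans_le (hj _ (Finset.mem_univ _))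
  have hgj0 : g j ≠ 0 := norm_pos_iff.1 hgj
  let c : BasisIndex K → ℤ_[p] := fun i => ⟨g i / g j, by
    rw [norm_div]
    exact div_le_one_of_le₀ (hj i (Finset.mem_univ _)) hgj.le⟩
  have hc : ∑ i, (c i : ℚ_[p]) • algebraMap K (LocalProduct K p) (integralBasis K i) = 0 := by
    simp only [c, div_eq_inv_mul, mul_smul]
    rw [← Finset.smul_sum, hg, smul_zero]
  have h1 := prime_dvd_of_sum_eq_zero p c hc j
  have h2 : c j = 1 := Subtype.ext (div_self hgj0)
  rw [h2] at h1
  exact PadicInt.prime_p.not_isUnit (isUnit_of_dvd_one h1)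

/-- A large power of `p` moves any element into the product of the local rings of integers. -/
theorem top_le_span_localProduct (p : ℕ) [Fact p.Prime] :
    ⊤ ≤ Submodule.span ℚ_[p]
      (Set.range fun i => algebraMap K (LocalProduct K p) (integralBasis K i)) := by
  rintro a -
  have hp0 : (p : ℚ_[p]) ≠ 0 := by exact_mod_cast (Fact.out : p.Prime).ne_zero
  have hlim : ∀ w : PlacesOver K p, ∀ᶠ n : ℕ in Filter.atTop,
      ‖algebraMap K (w.1.adicCompletion K) (p : 𝓞 K)‖ ^ n * ‖a w‖ < 1 := fun w => by
    have h := (tendsto_pow_atTop_nhds_zero_of_lt_one (norm_nonneg _)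
      (norm_algebraMap_prime_lt_one p w)).mul_const ‖a w‖
    rw [zero_mul] at h
    exact h.eventually (gt_mem_nhds one_pos)
  obtain ⟨n, hn⟩ := (Filter.eventually_all.2 hlim).exists
  obtain ⟨c, hc⟩ := exists_padicInt_combination p ((p : ℚ_[p]) ^ n • a) fun w => by
    rw [mem_adicCompletionIntegers_iff_norm_le_one, Pi.smul_apply, Algebra.smul_def, map_pow,
      map_natCast, norm_mul, norm_pow]
    simpa using (hn w).le
  rw [← Submodule.smul_mem_iff _ (pow_ne_zero n hp0), hc]
  exact sum_mem fun i _ => Submodule.smul_mem _ _ (Submodule.subset_span ⟨i, rfl⟩)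

variable (K) in
/-- An integral basis of `K`, as a basis over `ℚ_p` of the product of the completions of `K` at
the places above `p`. -/
noncomputable def localBasis (p : ℕ) [Fact p.Prime] :
    Module.Basis (BasisIndex K) ℚ_[p] (LocalProduct K p) :=
  Module.Basis.mk (linearIndependent_localProduct p) (top_le_span_localProduct p)

theorem localBasis_apply (p : ℕ) [Fact p.Prime] (i : BasisIndex K) :
    localBasis K p i = algebraMap K (LocalProduct K p) (integralBasis K i) :=
  Module.Basis.mk_apply _ _ _

instance (p : ℕ) [Fact p.Prime] : FiniteDimensional ℚ_[p] (LocalProduct K p) :=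
  (localBasis K p).finiteDimensional_of_finite

instance (p : ℕ) [Fact p.Prime] (w : PlacesOver K p) :
    FiniteDimensional ℚ_[p] (w.1.adicCompletion K) :=
  Module.Finite.of_surjective
    (LinearMap.proj w : LocalProduct K p →ₗ[ℚ_[p]] w.1.adicCompletion K)
    (Function.surjective_eval w)

/-! ### Local traces and the inverse different -/

/-- Multiplication by `x` is block diagonal, and cyclicity of the trace reduces each block to its
factor. -/
theorem trace_pi_apply {R ι : Type*} [Field R] [Fintype ι] {A : ι → Type*}
    [∀ i, CommRing (A i)] [∀ i, Algebra R (A i)] [∀ i, FiniteDimensional R (A i)]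
    (x : ∀ i, A i) : Algebra.trace R (∀ i, A i) x = ∑ i, Algebra.trace R (A i) (x i) := by
  classical
  have h : Algebra.lmul R (∀ i, A i) x = ∑ i, LinearMap.single R A i ∘ₗ
      (Algebra.lmul R (A i) (x i) ∘ₗ LinearMap.proj i) := by
    refine LinearMap.ext fun y => funext fun j => ?_
    simp only [LinearMap.sum_apply, Finset.sum_apply, LinearMap.comp_apply, LinearMap.proj_apply,
      LinearMap.single_apply]
    rw [Finset.sum_pi_single]
    simp
  rw [Algebra.trace_apply, h, map_sum]
  refine Finset.sum_congr rfl fun i _ => ?_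
  rw [LinearMap.trace_comp_comm', LinearMap.comp_assoc, LinearMap.proj_comp_single_same,
    LinearMap.comp_id, Algebra.trace_apply]

theorem trace_localProduct_apply (p : ℕ) [Fact p.Prime] (x : LocalProduct K p) :
    Algebra.trace ℚ_[p] (LocalProduct K p) x = ∑ w : PlacesOver K p, finiteTrace w.1 p w.2 (x w) :=
  trace_pi_apply x

theorem algebraMap_localProduct_eq_sum_repr {ι : Type*} [Fintype ι] (b : Module.Basis ι ℚ K)
    (p : ℕ) [Fact p.Prime] (k : K) :
    algebraMap K (LocalProduct K p) k =
      ∑ i, (b.repr k i : ℚ_[p]) • algebraMap K (LocalProduct K p) (b i) := by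
  conv_lhs => rw [← b.sum_repr k, map_sum]
  simp_rw [Rat.smul_def, map_mul, ratCast_smul_localProduct]

/-- The integral basis is a basis both over `ℚ` and over `ℚ_p`, and multiplication by `k` has the
same rational matrix in both. -/
theorem trace_localProduct_algebraMap (p : ℕ) [Fact p.Prime] (k : K) :
    Algebra.trace ℚ_[p] (LocalProduct K p) (algebraMap K (LocalProduct K p) k) =
      (Algebra.trace ℚ K k : ℚ_[p]) := by
  classical
  have h : Algebra.leftMulMatrix (localBasis K p) (algebraMap K (LocalProduct K p) k) =
      (Algebra.leftMulMatrix (integralBasis K) k).map (Rat.castHom ℚ_[p]) := by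
    ext i j
    rw [Algebra.leftMulMatrix_eq_repr_mul, Matrix.map_apply, Algebra.leftMulMatrix_eq_repr_mul,
      localBasis_apply, ← map_mul, algebraMap_localProduct_eq_sum_repr (integralBasis K)]
    simp_rw [← localBasis_apply]
    rw [Module.Basis.repr_sum_self]
    rfl
  rw [Algebra.trace_eq_matrix_trace (localBasis K p), h,
    Algebra.trace_eq_matrix_trace (integralBasis K)]
  exact (AddMonoidHom.map_trace (Rat.castHom ℚ_[p]) _).symm

variable (K) in
/-- The basis of `K` dual to the integral basis with respect to the trace form. -/
noncomputable def dualIntegralBasis : Module.Basis (BasisIndex K) ℚ K :=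
  open Classical in (integralBasis K).traceDual

theorem trace_integralBasis_mul_dual [DecidableEq (BasisIndex K)] (i j : BasisIndex K) :
    Algebra.trace ℚ K (integralBasis K i * dualIntegralBasis K j) = if i = j then 1 else 0 := by
  rw [dualIntegralBasis]
  convert (integralBasis K).trace_mul_traceDual i j

/-- Expansion in the dual of the integral basis. -/
theorem eq_sum_trace_smul_dual (p : ℕ) [Fact p.Prime] (d : LocalProduct K p) :
    d = ∑ i, Algebra.trace ℚ_[p] (LocalProduct K p)
        (algebraMap K (LocalProduct K p) (integralBasis K i) * d) •
      algebraMap K (LocalProduct K p) (dualIntegralBasis K i) := by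
  classical
  have hspan : d ∈ Submodule.span ℚ_[p]
      (Set.range fun i => algebraMap K (LocalProduct K p) (dualIntegralBasis K i)) := by
    refine (top_le_span_localProduct p).trans (Submodule.span_le.2 ?_) (Submodule.mem_top (x := d))
    rintro _ ⟨i, rfl⟩
    beta_reduce
    rw [algebraMap_localProduct_eq_sum_repr (dualIntegralBasis K)]
    exact sum_mem fun j _ => Submodule.smul_mem _ _ (Submodule.subset_span ⟨j, rfl⟩)
  obtain ⟨g, rfl⟩ := (Submodule.mem_span_range_iff_exists_fun _).1 hspan
  refine Finset.sum_congr rfl fun i _ => ?_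
  congr 1
  simp_rw [Finset.mul_sum, mul_smul_comm, map_sum, map_smul, ← map_mul,
    trace_localProduct_algebraMap, trace_integralBasis_mul_dual]
  simp [apply_ite (fun q : ℚ => (q : ℚ_[p]))]

theorem trace_mul_sum_dual (p : ℕ) [Fact p.Prime] (c : BasisIndex K → ℚ_[p]) (i : BasisIndex K) :
    Algebra.trace ℚ_[p] (LocalProduct K p) (algebraMap K (LocalProduct K p) (integralBasis K i) *
      ∑ j, c j • algebraMap K (LocalProduct K p) (dualIntegralBasis K j)) = c i := by
  classical
  simp_rw [Finset.mul_sum, mul_smul_comm, map_sum, map_smul, ← map_mul,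
    trace_localProduct_algebraMap, trace_integralBasis_mul_dual]
  simp [apply_ite (fun q : ℚ => (q : ℚ_[p]))]

/-- Only one prime lies below `w`, so the quantifier over primes in the definition is harmless. -/
theorem mem_localInverseDifferent_iff (p : ℕ) [Fact p.Prime] (w : PlacesOver K p)
    (b : w.1.adicCompletion K) : b ∈ localInverseDifferent w.1 ↔
      ∀ a ∈ w.1.adicCompletionIntegers K, finiteTrace w.1 p w.2 (a * b) ∈ PadicInt.subring p := by
  refine ⟨fun h => h ⟨p, Fact.out⟩ w.2, fun h q hq a ha => ?_⟩
  obtain ⟨q, hq'⟩ := q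
  obtain rfl := eq_of_mem_asIdeal w.1 hq' (Fact.out : p.Prime) hq w.2
  exact h a ha

/-- The product of the local inverse differents is the dual lattice of the product of the local
rings of integers. -/
theorem forall_mem_localInverseDifferent_iff (p : ℕ) [Fact p.Prime] (d : LocalProduct K p) :
    (∀ w, d w ∈ localInverseDifferent w.1) ↔ ∀ i, Algebra.trace ℚ_[p] (LocalProduct K p)
      (algebraMap K (LocalProduct K p) (integralBasis K i) * d) ∈ PadicInt.subring p := by
  classical
  refine ⟨fun h i => ?_, fun h w => (mem_localInverseDifferent_iff p w _).2 fun a ha => ?_⟩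
  · rw [trace_localProduct_apply]
    refine sum_mem fun w _ => (mem_localInverseDifferent_iff p w _).1 (h w) _ ?_
    rw [integralBasis_apply]
    exact algebraMap_integer_mem w.1 _
  -- Extending `a` by zero to the other places above `p` isolates the local trace at `w`.
  · obtain ⟨c, hc⟩ := exists_padicInt_combination p (Pi.single w a) fun w' => by
      obtain rfl | hne := eq_or_ne w' w
      · rwa [Pi.single_eq_same]
      · rw [Pi.single_eq_of_ne hne]
        exact zero_mem _
    have h1 : finiteTrace w.1 p w.2 (a * d w) =
        Algebra.trace ℚ_[p] (LocalProduct K p) (Pi.single w a * d) := by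
      rw [trace_localProduct_apply, Finset.sum_eq_single w]
      · rw [Pi.mul_apply, Pi.single_eq_same]
      · intro w' _ hne
        rw [Pi.mul_apply, Pi.single_eq_of_ne hne, zero_mul]
        exact map_zero (Algebra.trace ℚ_[p] (w'.1.adicCompletion K))
      · simp
    rw [h1, hc, Finset.sum_mul, map_sum]
    refine sum_mem fun i _ => ?_
    rw [smul_mul_assoc, map_smul, smul_eq_mul]
    exact mul_mem (c i).2 (h i)

/-! ### The characters of `ℚ_p` and of `ℚ / ℤ` -/

theorem exp_two_pi_mul_eq_one_iff (r : ℚ) :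
    Circle.exp (2 * Real.pi * (r : ℝ)) = 1 ↔ ∃ m : ℤ, r = m := by
  rw [Circle.exp_eq_one]
  have hpi : (2 * Real.pi : ℝ) ≠ 0 := by positivity
  refine exists_congr fun m => ?_
  rw [mul_comm (2 * Real.pi), mul_left_inj' hpi]
  exact_mod_cast Iff.rfl

theorem exists_int_of_norm_le_one (p : ℕ) [Fact p.Prime] {m : ℤ} {n : ℕ}
    (h : ‖(((m : ℚ) / (p : ℚ) ^ n : ℚ) : ℚ_[p])‖ ≤ 1) : ∃ k : ℤ, (m : ℚ) / (p : ℚ) ^ n = k := by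
  have hp : (p : ℚ) ≠ 0 := by exact_mod_cast (Fact.out : p.Prime).ne_zero
  have hpp : 0 < ‖(p : ℚ_[p]) ^ n‖ :=
    norm_pos_iff.2 (pow_ne_zero _ (by exact_mod_cast (Fact.out : p.Prime).ne_zero))
  push_cast at h
  rw [norm_div, div_le_one hpp, Padic.norm_p_pow, Padic.norm_int_le_pow_iff_dvd] at h
  obtain ⟨k, rfl⟩ := h
  refine ⟨k, ?_⟩
  push_cast
  field_simp

/-- Two principal parts of `x` differ by an element of `ℤ[1/p]` that is `p`-integral, hence by an
integer; the choice made in `principalPart` is therefore immaterial. -/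
theorem padicChar_eq_exp (p : ℕ) [Fact p.Prime] (x : ℚ_[p]) {m : ℤ} {n : ℕ}
    (h : x - (((m : ℚ) / (p : ℚ) ^ n : ℚ) : ℚ_[p]) ∈ PadicInt.subring p) :
    padicChar p x = Circle.exp (2 * Real.pi * (((m : ℚ) / (p : ℚ) ^ n : ℚ) : ℝ)) := by
  have hp : (p : ℚ) ≠ 0 := by exact_mod_cast (Fact.out : p.Prime).ne_zero
  obtain ⟨⟨m', n', hr⟩, h'⟩ := (exists_padic_principalPart p x).choose_spec
  rw [padicChar, ← div_eq_one, ← Circle.exp_sub]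
  change principalPart p x = _ at hr
  change x - (principalPart p x : ℚ_[p]) ∈ _ at h'
  rw [hr] at h' ⊢
  have hsub : (m' : ℚ) / (p : ℚ) ^ n' - (m : ℚ) / (p : ℚ) ^ n =
      ((m' * (p : ℤ) ^ n - m * (p : ℤ) ^ n' : ℤ) : ℚ) / (p : ℚ) ^ (n' + n) := by
    push_cast
    field_simp
    ring
  rw [← mul_sub, ← Rat.cast_sub, exp_two_pi_mul_eq_one_iff, hsub]
  refine exists_int_of_norm_le_one p ?_
  rw [← hsub, Rat.cast_sub]
  have := (PadicInt.subring p).sub_mem h h'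
  rwa [sub_sub_sub_cancel_left] at this

theorem padicChar_eq_one_iff (p : ℕ) [Fact p.Prime] (x : ℚ_[p]) :
    padicChar p x = 1 ↔ x ∈ PadicInt.subring p := by
  refine ⟨fun h => ?_, fun h => ?_⟩
  · rw [padicChar, exp_two_pi_mul_eq_one_iff] at h
    obtain ⟨k, hk⟩ := h
    have h' := (exists_padic_principalPart p x).choose_spec.2
    change x - (principalPart p x : ℚ_[p]) ∈ _ at h'
    rw [hk, Rat.cast_intCast] at h'
    simpa using (PadicInt.subring p).add_mem h' (intCast_mem _ k)
  · rw [padicChar_eq_exp p x (m := 0) (n := 0) (by simpa using h)]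
    simp

theorem padicChar_add (p : ℕ) [Fact p.Prime] (x y : ℚ_[p]) :
    padicChar p (x + y) = padicChar p x * padicChar p y := by
  have hp : (p : ℚ) ≠ 0 := by exact_mod_cast (Fact.out : p.Prime).ne_zero
  obtain ⟨_, ⟨m, n, rfl⟩, h⟩ := exists_padic_principalPart p x
  obtain ⟨_, ⟨m', n', rfl⟩, h'⟩ := exists_padic_principalPart p y
  have hadd : (m : ℚ) / (p : ℚ) ^ n + (m' : ℚ) / (p : ℚ) ^ n' =
      ((m * (p : ℤ) ^ n' + m' * (p : ℤ) ^ n : ℤ) : ℚ) / (p : ℚ) ^ (n + n') := by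
    push_cast
    field_simp
    ring
  have hxy := (PadicInt.subring p).add_mem h h'
  rw [← add_sub_add_comm, ← Rat.cast_add, hadd] at hxy
  rw [padicChar_eq_exp p x h, padicChar_eq_exp p y h', padicChar_eq_exp p _ hxy, ← hadd,
    ← Circle.exp_add, Rat.cast_add, mul_add]

theorem padicChar_eq_of_sub_mem (p : ℕ) [Fact p.Prime] {x y : ℚ_[p]}
    (h : x - y ∈ PadicInt.subring p) : padicChar p x = padicChar p y := by
  rw [← sub_add_cancel x y, padicChar_add, (padicChar_eq_one_iff p _).2 h, one_mul]

/-- The character is trivial on `ℤ_p`, which contains the open unit ball, so it is locally constant.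
-/
theorem continuous_padicChar (p : ℕ) [Fact p.Prime] : Continuous (padicChar p) := by
  refine continuous_iff_continuousAt.2 fun x => ?_
  refine continuousAt_const.congr (f := fun _ => padicChar p x) ?_
  filter_upwards [Metric.ball_mem_nhds x one_pos] with y hy
  refine padicChar_eq_of_sub_mem p ?_
  rw [Metric.mem_ball, dist_comm, dist_eq_norm] at hy
  exact hy.le

theorem norm_ratCast_mul_le_one {p : ℕ} [Fact p.Prime] {q : ℚ} (hq : ¬ p ∣ q.den) {x : ℚ_[p]}
    (hx : x ∈ PadicInt.subring p) : (q : ℚ_[p]) * x ∈ PadicInt.subring p :=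
  mul_mem (show (q : ℚ_[p]) ∈ PadicInt.subring p from Padic.norm_rat_le_one hq) hx

/-! ### Characters of `ℚ` trivial on `ℤ` -/

theorem finite_primes_dvd {n : ℕ} (hn : n ≠ 0) : {p : Nat.Primes | p.1 ∣ n}.Finite :=
  (n.primeFactors.finite_toSet.preimage Subtype.val_injective.injOn).subset
    fun p hp => Nat.mem_primeFactors.2 ⟨p.2, hp, hn⟩

theorem mulSupport_padicChar_subset (c : ∀ p : Nat.Primes, ℤ_[p.1]) (q : ℚ) :
    Function.mulSupport (fun p : Nat.Primes => padicChar p.1 (q * c p)) ⊆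
      {p : Nat.Primes | p.1 ∣ q.den} := by
  intro p hp
  by_contra hq
  exact hp ((padicChar_eq_one_iff _ _).2 (norm_ratCast_mul_le_one hq (c p).2))

/-- The character `q ↦ ∏_p χ_p(q c_p)` of `ℚ` for a family `(c_p)` of `p`-adic integers. -/
noncomputable def padicProductChar (c : ∀ p : Nat.Primes, ℤ_[p.1]) : AddChar ℚ Circle where
  toFun q := ∏ᶠ p : Nat.Primes, padicChar p.1 (q * c p)
  map_zero_eq_one' := finprod_eq_one_of_forall_eq_one fun p => by
    rw [padicChar_eq_one_iff]
    simp
  map_add_eq_mul' q r := by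
    rw [← finprod_mul_distrib
      ((finite_primes_dvd q.den_ne_zero).subset (mulSupport_padicChar_subset c q))
      ((finite_primes_dvd r.den_ne_zero).subset (mulSupport_padicChar_subset c r))]
    refine finprod_congr fun p => ?_
    rw [Rat.cast_add, add_mul, padicChar_add]

theorem padicProductChar_apply (c : ∀ p : Nat.Primes, ℤ_[p.1]) (q : ℚ) :
    padicProductChar c q = ∏ᶠ p : Nat.Primes, padicChar p.1 (q * c p) := rfl

/-- At every prime other than `p` the argument is integral, so only the factor at `p` survives. -/
theorem padicProductChar_inv_prime_pow (c : ∀ p : Nat.Primes, ℤ_[p.1]) (p : Nat.Primes) (n : ℕ) :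
    padicProductChar c (((p.1 : ℚ) ^ n)⁻¹) = padicChar p.1 (c p / (p.1 : ℚ_[p.1]) ^ n) := by
  rw [padicProductChar_apply, finprod_eq_single _ p]
  · push_cast
    rw [div_eq_inv_mul]
  · intro l hl
    rw [padicChar_eq_one_iff]
    refine norm_ratCast_mul_le_one (fun h => hl ?_) (c l).2
    have hden : ((p.1 : ℚ) ^ n)⁻¹.den = p.1 ^ n := by
      rw [← Nat.cast_pow, Rat.inv_natCast_den_of_pos (pow_pos p.2.pos n)]
    rw [hden] at h
    exact Subtype.ext ((Nat.prime_dvd_prime_iff_eq l.2 p.2).1 (l.2.dvd_of_dvd_pow h))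

/-- Evaluating at `1 / p ^ n` shows that every power of `p` divides `c p`. -/
theorem padicProductChar_injective {c : ∀ p : Nat.Primes, ℤ_[p.1]}
    (h : ∀ q, padicProductChar c q = 1) : c = 0 := by
  funext p
  have h1 (n : ℕ) : ‖(c p : ℚ_[p.1])‖ ≤ ‖(p.1 : ℚ_[p.1])‖ ^ n := by
    have hpp : 0 < ‖(p.1 : ℚ_[p.1]) ^ n‖ :=
      norm_pos_iff.2 (pow_ne_zero _ (by exact_mod_cast p.2.ne_zero))
    have h2 := h (((p.1 : ℚ) ^ n)⁻¹)
    rw [padicProductChar_inv_prime_pow, padicChar_eq_one_iff] at h2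
    change ‖_‖ ≤ 1 at h2
    rwa [norm_div, div_le_one hpp, norm_pow] at h2
  have h2 : ‖(c p : ℚ_[p.1])‖ ≤ 0 := ge_of_tendsto'
    (tendsto_pow_atTop_nhds_zero_of_lt_one (norm_nonneg _) Padic.norm_p_lt_one) h1
  exact Subtype.ext (norm_le_zero_iff.1 h2)

/-- The inverses of prime powers generate the additive group `ℚ`: for coprime `a`, `b`, Bézout
splits `1 / (a b)` into multiples of `1 / a` and `1 / b`. -/
theorem addChar_eq_of_inv_prime_pow {χ ψ : AddChar ℚ Circle}
    (h : ∀ (p : Nat.Primes) (n : ℕ), χ (((p.1 : ℚ) ^ n)⁻¹) = ψ (((p.1 : ℚ) ^ n)⁻¹)) : χ = ψ := by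
  have hinv : ∀ n : ℕ, n ≠ 0 → χ ((n : ℚ)⁻¹) = ψ ((n : ℚ)⁻¹) := by
    intro n
    induction n using Nat.recOnPrimeCoprime with
    | zero => simp
    | prime_pow p n hp => exact fun _ => by simpa using h ⟨p, hp⟩ n
    | coprime a b ha hb hab iha ihb =>
      intro hne
      have ha0 : (a : ℚ) ≠ 0 := by positivity
      have hb0 : (b : ℚ) ≠ 0 := by positivity
      obtain ⟨u, v, huv⟩ := Nat.isCoprime_iff_coprime.mpr hab
      have huv' : (u : ℚ) * a + v * b = 1 := by exact_mod_cast huv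
      have hab' : ((a * b : ℕ) : ℚ)⁻¹ = u • (b : ℚ)⁻¹ + v • (a : ℚ)⁻¹ := by
        rw [zsmul_eq_mul, zsmul_eq_mul]
        push_cast
        field_simp
        linarith
      rw [hab', AddChar.map_add_eq_mul, AddChar.map_add_eq_mul, AddChar.map_zsmul_eq_zpow,
        AddChar.map_zsmul_eq_zpow, AddChar.map_zsmul_eq_zpow, AddChar.map_zsmul_eq_zpow,
        iha (by positivity), ihb (by positivity)]
  ext1 q
  have hq : q = q.num • (q.den : ℚ)⁻¹ := by
    rw [zsmul_eq_mul, ← div_eq_mul_inv, Rat.num_div_den]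
  rw [hq, AddChar.map_zsmul_eq_zpow, AddChar.map_zsmul_eq_zpow, hinv _ q.den_ne_zero]

/-- Since `χ 1 = 1`, the value at `1 / p ^ n` is a `p ^ n`-th root of unity `exp(2πi a_n / p ^ n)`.
Compatibility under `p`-th powers gives `a_{n+1} ≡ a_n` modulo `p ^ n`, and `c` is the `p`-adic
limit of the `a_n`. -/
theorem exists_padicInt_addChar_eq (χ : AddChar ℚ Circle) (h1 : χ 1 = 1) (p : ℕ) [Fact p.Prime] :
    ∃ c : ℤ_[p], ∀ n : ℕ, χ (((p : ℚ) ^ n)⁻¹) = padicChar p (c / (p : ℚ_[p]) ^ n) := by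
  have hp : (p : ℚ) ≠ 0 := by exact_mod_cast (Fact.out : p.Prime).ne_zero
  have hpp : (p : ℚ_[p]) ≠ 0 := by exact_mod_cast (Fact.out : p.Prime).ne_zero
  have hex : ∀ n : ℕ, ∃ m : ℤ, χ (((p : ℚ) ^ n)⁻¹) =
      Circle.exp (2 * Real.pi * (((m : ℚ) / (p : ℚ) ^ n : ℚ) : ℝ)) := by
    intro n
    obtain ⟨t, ht⟩ := Circle.exp_surjective (χ (((p : ℚ) ^ n)⁻¹))
    have h2 : χ (((p : ℚ) ^ n)⁻¹) ^ (p ^ n) = 1 := by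
        rw [← AddChar.map_nsmul_eq_pow, nsmul_eq_mul, Nat.cast_pow,
        mul_inv_cancel₀ (pow_ne_zero n hp), h1]
    rw [← ht, ← Circle.exp_nsmul, Circle.exp_eq_one] at h2
    obtain ⟨m, hm⟩ := h2
    refine ⟨m, ?_⟩
    rw [← ht]
    congr 1
    have hpR : (p : ℝ) ≠ 0 := by exact_mod_cast hp
    rw [nsmul_eq_mul] at hm
    push_cast at hm ⊢
    field_simp
    linarith
  choose a ha using hex
  have hdvd (n : ℕ) : (p : ℤ) ^ n ∣ a (n + 1) - a n := by
    have h2 : χ (((p : ℚ) ^ (n + 1))⁻¹) ^ p = χ (((p : ℚ) ^ n)⁻¹) := by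
      rw [← AddChar.map_nsmul_eq_pow, nsmul_eq_mul]
      congr 1
      rw [pow_succ]
      field_simp
    rw [ha, ha, ← Circle.exp_nsmul, ← div_eq_one, ← Circle.exp_sub] at h2
    have h3 : p • (2 * Real.pi * (((a (n + 1) : ℚ) / (p : ℚ) ^ (n + 1) : ℚ) : ℝ)) -
        2 * Real.pi * (((a n : ℚ) / (p : ℚ) ^ n : ℚ) : ℝ) =
        2 * Real.pi * ((((a (n + 1) - a n : ℤ) : ℚ) / (p : ℚ) ^ n : ℚ) : ℝ) := by
      have hpR : (p : ℝ) ≠ 0 := by exact_mod_cast hp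
      rw [nsmul_eq_mul]
      push_cast
      field_simp
      ring
    rw [h3, exp_two_pi_mul_eq_one_iff] at h2
    obtain ⟨k, hk⟩ := h2
    refine ⟨k, ?_⟩
    rw [div_eq_iff (pow_ne_zero n hp)] at hk
    rw [mul_comm]
    exact_mod_cast hk
  refine ⟨PadicInt.ofIntSeq _ (PadicInt.isCauSeq_padicNorm_of_pow_dvd_sub a p hdvd), fun n => ?_⟩
  set c := PadicInt.ofIntSeq _ (PadicInt.isCauSeq_padicNorm_of_pow_dvd_sub a p hdvd)
  -- As `c ≡ a n` modulo `p ^ n`, the rational `a n / p ^ n` is a principal part of `c / p ^ n`.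
  have hc : PadicInt.toZModPow n (c - (a n : ℤ_[p])) = 0 := by
    rw [map_sub, map_intCast, PadicInt.toZModPow_ofIntSeq_of_pow_dvd_sub a p hdvd, sub_self]
  rw [← RingHom.mem_ker, PadicInt.ker_toZModPow, Ideal.mem_span_singleton] at hc
  obtain ⟨d, hd⟩ := hc
  rw [ha, padicChar_eq_exp p _ (m := a n) (n := n)]
  have hd' : (c : ℚ_[p]) - a n = (p : ℚ_[p]) ^ n * d := by
    simpa using congrArg (fun z : ℤ_[p] => (z : ℚ_[p])) hd
  have h2 : (c : ℚ_[p]) / (p : ℚ_[p]) ^ n - (((a n : ℚ) / (p : ℚ) ^ n : ℚ) : ℚ_[p]) = d := by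
    push_cast
    rw [← sub_div, hd', mul_div_cancel_left₀ _ (pow_ne_zero n hpp)]
  rw [h2]
  exact d.2

/-- Every character of `ℚ / ℤ` is of the form `q ↦ ∏_p χ_p(q c_p)`. -/
theorem exists_padicProductChar_eq (χ : AddChar ℚ Circle) (h1 : χ 1 = 1) :
    ∃ c : ∀ p : Nat.Primes, ℤ_[p.1], padicProductChar c = χ := by
  choose c hc using fun p : Nat.Primes => exists_padicInt_addChar_eq χ h1 p.1
  refine ⟨c, addChar_eq_of_inv_prime_pow fun p n => ?_⟩
  rw [padicProductChar_inv_prime_pow, hc]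

/-! ### The product of the local inverse differents in the adeles -/

variable (K) in
theorem exists_mul_mem_of_mem_localInverseDifferent :
    ∃ N : 𝓞 K, N ≠ 0 ∧ ∀ (v : HeightOneSpectrum (𝓞 K)), ∀ b ∈ localInverseDifferent v,
      algebraMap K (v.adicCompletion K) N * b ∈ v.adicCompletionIntegers K := by
  classical
  -- `N` is a common denominator of the dual basis. It works at all places at once, because elements
  -- of the local inverse differents have `ℤ_p`-coordinates in that basis.
  obtain ⟨N, hN⟩ := IsLocalization.exist_integer_multiples (nonZeroDivisors (𝓞 K)) Finset.univ
    (dualIntegralBasis K)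
  refine ⟨N, nonZeroDivisors.ne_zero N.2, fun v b hb => ?_⟩
  obtain ⟨p, hp⟩ := exists_prime_mem_asIdeal v
  obtain ⟨w, rfl⟩ : ∃ w : PlacesOver K p.1, w.1 = v := ⟨⟨v, hp⟩, rfl⟩
  have hd : ∀ w', (Pi.single w b : LocalProduct K p.1) w' ∈ localInverseDifferent w'.1 := by
    intro w'
    obtain rfl | hne := eq_or_ne w' w
    · rwa [Pi.single_eq_same]
    · rw [Pi.single_eq_of_ne hne]
      exact zero_mem _
  have hb' : b = (Pi.single w b : LocalProduct K p.1) w := by rw [Pi.single_eq_same]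
  rw [hb', eq_sum_trace_smul_dual p.1 (Pi.single w b), Finset.sum_apply, Finset.mul_sum]
  refine sum_mem fun i _ => ?_
  rw [Pi.smul_apply, mul_smul_comm]
  refine padicInt_smul_mem p.1 w ⟨_, (forall_mem_localInverseDifferent_iff p.1 _).1 hd i⟩ ?_
  rw [algebraMap_localProduct_apply, ← map_mul]
  obtain ⟨y, hy⟩ := hN i (Finset.mem_univ i)
  have hy' : ((N : 𝓞 K) : K) * dualIntegralBasis K i = y := by
    rw [Algebra.smul_def] at hy
    exact hy.symm
  rw [hy']
  exact algebraMap_integer_mem w.1 y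

variable (K) in
/-- The embedding of the product of the local inverse differents in the finite adeles is
continuous. -/
theorem exists_continuous_finiteAdele :
    ∃ f : (∀ v : HeightOneSpectrum (𝓞 K), localInverseDifferent v) → FiniteAdeleRing (𝓞 K) K,
      Continuous f ∧ ∀ d v, f d v = d v := by
  obtain ⟨N, hN0, hN⟩ := exists_mul_mem_of_mem_localInverseDifferent K
  have hNK : (N : K) ≠ 0 := by simpa using hN0
  -- Multiplication by `N` lands in the product of the local integers, where the restricted product
  -- has the product topology; multiplying back by `N⁻¹` is continuous on the adeles.
  let g : (∀ v : HeightOneSpectrum (𝓞 K), localInverseDifferent v) →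
      FiniteAdeleRing (𝓞 K) K := fun d =>
    RestrictedProduct.structureMap (fun v : HeightOneSpectrum (𝓞 K) => v.adicCompletion K)
      (fun v => (v.adicCompletionIntegers K : Set (v.adicCompletion K))) Filter.cofinite
      fun v => ⟨algebraMap K (v.adicCompletion K) N * d v, hN v _ (d v).2⟩
  have hg : Continuous g := by
    refine RestrictedProduct.isEmbedding_structureMap.continuous.comp ?_
    refine continuous_pi fun v => Continuous.subtype_mk ?_ _
    exact continuous_const.mul (continuous_subtype_val.comp (continuous_apply v))
  refine ⟨fun d => algebraMap K (FiniteAdeleRing (𝓞 K) K) (N : K)⁻¹ * g d,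
    continuous_const.mul hg, fun d v => ?_⟩
  change algebraMap K (v.adicCompletion K) (N : K)⁻¹ *
    (algebraMap K (v.adicCompletion K) N * d v) = _
  rw [← mul_assoc, ← map_mul, inv_mul_cancel₀ hNK, map_one, one_mul]

theorem continuous_adele_apply (v : HeightOneSpectrum (𝓞 K)) :
    Continuous fun b : AdeleRing (𝓞 K) K => b.2 v :=
  (RestrictedProduct.continuous_eval v).comp continuous_snd

variable (K) in
/-- The product of the local inverse differents is the adelic inverse different. -/
theorem exists_inverseDifferent_continuousAddEquiv :
    ∃ ι : (∀ v : HeightOneSpectrum (𝓞 K), localInverseDifferent v) ≃ₜ+ adelicInverseDifferent K,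
      ∀ d, (ι d : AdeleRing (𝓞 K) K).1 = 0 ∧
        ∀ v : HeightOneSpectrum (𝓞 K), (ι d : AdeleRing (𝓞 K) K).2 v = d v := by
  obtain ⟨f, hf, hfd⟩ := exists_continuous_finiteAdele K
  let ι : (∀ v : HeightOneSpectrum (𝓞 K), localInverseDifferent v) ≃ₜ+ adelicInverseDifferent K :=
    { toFun := fun d => ⟨((0, f d) : InfiniteAdeleRing K × FiniteAdeleRing (𝓞 K) K), rfl,
        fun v => (hfd d v).symm ▸ (d v).2⟩
      invFun := fun b v => ⟨(b : AdeleRing (𝓞 K) K).2 v, b.2.2 v⟩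
      left_inv := fun d => funext fun v => Subtype.ext (hfd d v)
      right_inv := fun b => Subtype.ext
        (Prod.ext b.2.1.symm (FiniteAdeleRing.ext K fun v => hfd _ v))
      map_add' := fun d d' => Subtype.ext (Prod.ext (add_zero 0).symm
        (FiniteAdeleRing.ext K fun v =>
          (hfd _ v).trans (congrArg₂ (· + ·) (hfd d v) (hfd d' v)).symm))
      continuous_toFun := Continuous.subtype_mk (continuous_const.prodMk hf) _
      continuous_invFun := continuous_pi fun v => Continuous.subtype_mk
        ((continuous_adele_apply v).comp continuous_subtype_val) _ }
  exact ⟨ι, fun d => ⟨rfl, hfd d⟩⟩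

/-! ### Coordinates on the adelic inverse different -/

/-- The components of an adele at the places above `p`. -/
def localComponent (p : ℕ) (b : AdeleRing (𝓞 K) K) : LocalProduct K p := fun w => b.2 w.1

theorem adelicTrace_algebraMap_mul (k : K) (b : AdeleRing (𝓞 K) K) (p : Nat.Primes) :
    (adelicTrace K (algebraMap K (AdeleRing (𝓞 K) K) k * b)).2 p =
      Algebra.trace ℚ_[p.1] (LocalProduct K p.1)
        (algebraMap K (LocalProduct K p.1) k * localComponent p.1 b) := by
  rw [trace_localProduct_apply]
  exact finsum_eq_sum_of_fintype _

theorem adelicTrace_fst_eq_zero (a b : AdeleRing (𝓞 K) K) (hb : b.1 = 0) :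
    (adelicTrace K (a * b)).1 = 0 := by
  refine Finset.sum_eq_zero fun v _ => ?_
  have h : (a * b).1 v = 0 := by
    change a.1 v * b.1 v = 0
    rw [hb]
    exact mul_zero _
  rw [h, infiniteTrace]
  exact map_zero _

/-- The coordinates of an element of the adelic inverse different in the dual of the integral
basis. -/
noncomputable def dualCoord (b : adelicInverseDifferent K) (i : BasisIndex K) (p : Nat.Primes) :
    ℤ_[p.1] :=
  ⟨Algebra.trace ℚ_[p.1] (LocalProduct K p.1) (algebraMap K (LocalProduct K p.1)
    (integralBasis K i) * localComponent p.1 (b : AdeleRing (𝓞 K) K)),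
    (forall_mem_localInverseDifferent_iff p.1 _).1 (fun w => b.2.2 w.1) i⟩

theorem dualCoord_add (b b' : adelicInverseDifferent K) :
    dualCoord (b + b') = dualCoord b + dualCoord b' := by
  funext i p
  refine Subtype.ext ?_
  refine Eq.trans ?_ (map_add (Algebra.trace ℚ_[p.1] (LocalProduct K p.1)) _ _)
  rw [← mul_add]
  rfl

theorem continuous_dualCoord (i : BasisIndex K) (p : Nat.Primes) :
    Continuous fun b : adelicInverseDifferent K => dualCoord b i p := by
  refine Continuous.subtype_mk ?_ _
  refine (LinearMap.continuous_of_finiteDimensional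
    (Algebra.trace ℚ_[p.1] (LocalProduct K p.1))).comp (continuous_const.mul ?_)
  exact continuous_pi fun w => (continuous_adele_apply w.1).comp continuous_subtype_val

/-- Each finite place lies above some prime, and the components above it are recovered by expansion
in the dual basis. -/
theorem dualCoord_injective : Function.Injective (dualCoord (K := K)) := by
  intro b b' h
  refine Subtype.ext (Prod.ext (b.2.1.trans b'.2.1.symm) (FiniteAdeleRing.ext K fun v => ?_))
  obtain ⟨p, hp⟩ := exists_prime_mem_asIdeal v
  have h1 : localComponent p.1 (b : AdeleRing (𝓞 K) K) =
      localComponent p.1 (b' : AdeleRing (𝓞 K) K) := by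
    rw [eq_sum_trace_smul_dual p.1 (localComponent p.1 (b : AdeleRing (𝓞 K) K)),
      eq_sum_trace_smul_dual p.1 (localComponent p.1 (b' : AdeleRing (𝓞 K) K))]
    refine Finset.sum_congr rfl fun i _ => ?_
    congr 1
    exact congrArg Subtype.val (congrFun (congrFun h i) p)
  exact congrFun h1 ⟨v, hp⟩

variable (K) in
/-- The adelic inverse different has a continuous parametrization by its coordinates. -/
theorem exists_continuous_dualCoord_eq :
    ∃ σ : (BasisIndex K → ∀ p : Nat.Primes, ℤ_[p.1]) → adelicInverseDifferent K,
      Continuous σ ∧ ∀ c, dualCoord (σ c) = c := by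
  obtain ⟨ι, hι⟩ := exists_inverseDifferent_continuousAddEquiv K
  choose p hp using exists_prime_mem_asIdeal (K := K)
  let x (c : BasisIndex K → ∀ p : Nat.Primes, ℤ_[p.1]) (p : Nat.Primes) : LocalProduct K p.1 :=
    ∑ i, (c i p : ℚ_[p.1]) • algebraMap K (LocalProduct K p.1) (dualIntegralBasis K i)
  have hx (c p i) : Algebra.trace ℚ_[p.1] (LocalProduct K p.1)
      (algebraMap K (LocalProduct K p.1) (integralBasis K i) * x c p) = c i p :=
    trace_mul_sum_dual p.1 (fun i => (c i p : ℚ_[p.1])) i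
  have hmem (c p) : ∀ w, x c p w ∈ localInverseDifferent w.1 :=
    (forall_mem_localInverseDifferent_iff p.1 _).2 fun i => by rw [hx]; exact (c i p).2
  have hcont (p) : Continuous fun c => x c p := by
    refine continuous_finsetSum _ fun i _ => ?_
    have h : Continuous fun c : BasisIndex K → ∀ p : Nat.Primes, ℤ_[p.1] => (c i p : ℚ_[p.1]) :=
      continuous_subtype_val.comp ((continuous_apply p).comp (continuous_apply i))
    exact h.smul continuous_const
  let d (c : BasisIndex K → ∀ p : Nat.Primes, ℤ_[p.1]) (v : HeightOneSpectrum (𝓞 K)) :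
      localInverseDifferent v := ⟨x c (p v) ⟨v, hp v⟩, hmem c (p v) ⟨v, hp v⟩⟩
  refine ⟨fun c => ι (d c), ι.continuous.comp ?_, fun c => ?_⟩
  · exact continuous_pi fun v =>
      Continuous.subtype_mk
        ((continuous_apply (⟨v, hp v⟩ : PlacesOver K (p v).1)).comp (hcont (p v))) _
  · funext i q
    have h : localComponent q.1 (ι (d c) : AdeleRing (𝓞 K) K) = x c q := by
      funext ⟨v, hv⟩
      refine ((hι (d c)).2 v).trans ?_
      -- The prime chosen below `v` is the only one, so the components above `q` all come from the
      -- same `x c q`.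
      obtain rfl : q = p v := Subtype.ext (eq_of_mem_asIdeal v q.2 (p v).2 hv (hp v))
      rfl
    refine Subtype.ext ?_
    change Algebra.trace ℚ_[q.1] (LocalProduct K q.1)
      (algebraMap K (LocalProduct K q.1) (integralBasis K i) *
        localComponent q.1 (ι (d c) : AdeleRing (𝓞 K) K)) = _
    rw [h, hx]

/-- `σ` is a right inverse of the injective map `dualCoord`, hence surjective, and its source is a
product of compact spaces `ℤ_p`. -/
instance : CompactSpace (adelicInverseDifferent K) := by
  obtain ⟨σ, hσ, hc⟩ := exists_continuous_dualCoord_eq K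
  have hsurj : Function.Surjective σ := fun b =>
    ⟨dualCoord b, dualCoord_injective (hc _)⟩
  exact hsurj.compactSpace hσ

/-! ### The pairing and the characters of `K / 𝓞` -/

theorem realChar_zero : realChar 0 = 1 := by simp [realChar]

theorem padicChar_sum {ι : Type*} (p : ℕ) [Fact p.Prime] (s : Finset ι) (x : ι → ℚ_[p]) :
    padicChar p (∑ i ∈ s, x i) = ∏ i ∈ s, padicChar p (x i) := by
  classical
  induction s using Finset.induction_on with
  | empty => simp [padicChar_eq_one_iff]
  | insert i s hi ih => rw [Finset.sum_insert hi, Finset.prod_insert hi, padicChar_add, ih]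

theorem hasFiniteMulSupport_padicChar (c : ∀ p : Nat.Primes, ℤ_[p.1]) (q : ℚ) :
    Function.HasFiniteMulSupport fun p : Nat.Primes => padicChar p.1 (q * c p) :=
  (finite_primes_dvd q.den_ne_zero).subset (mulSupport_padicChar_subset c q)

theorem padicProductChar_add (c c' : ∀ p : Nat.Primes, ℤ_[p.1]) (q : ℚ) :
    padicProductChar (c + c') q = padicProductChar c q * padicProductChar c' q := by
  simp_rw [padicProductChar_apply]
  rw [← finprod_mul_distrib (hasFiniteMulSupport_padicChar c q)
    (hasFiniteMulSupport_padicChar c' q)]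
  refine finprod_congr fun p => ?_
  rw [Pi.add_apply, PadicInt.coe_add, mul_add, padicChar_add]

theorem padicProductChar_intCast (c : ∀ p : Nat.Primes, ℤ_[p.1]) (m : ℤ) :
    padicProductChar c m = 1 := by
  refine finprod_eq_one_of_forall_eq_one fun p => ?_
  rw [padicChar_eq_one_iff, Rat.cast_intCast]
  exact mul_mem (intCast_mem _ m) (c p).2

/-- For fixed `q` only the primes dividing its denominator contribute, whatever `c` is. -/
theorem continuous_padicProductChar (q : ℚ) :
    Continuous fun c : ∀ p : Nat.Primes, ℤ_[p.1] => padicProductChar c q := by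
  simp_rw [padicProductChar_apply]
  have h (c : ∀ p : Nat.Primes, ℤ_[p.1]) := finprod_eq_prod_of_mulSupport_subset_of_finite _
    (mulSupport_padicChar_subset c q) (finite_primes_dvd q.den_ne_zero)
  simp_rw [h]
  refine continuous_finsetProd _ fun p _ => (continuous_padicChar p.1).comp ?_
  have hp : Continuous fun c : ∀ p : Nat.Primes, ℤ_[p.1] => (c p : ℚ_[p.1]) :=
    continuous_subtype_val.comp (continuous_apply p)
  exact continuous_const.mul hp

/-- Expanding `k` in the integral basis turns `Tr(kb)_p` into the sum of the products of the
coordinates of `k` and `b`; the finite product over `i` then commutes with the product over `p`. -/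
theorem adelicPairing_algebraMap (b : adelicInverseDifferent K) (k : K) :
    adelicPairing K (algebraMap K (AdeleRing (𝓞 K) K) k) b =
      ∏ i, padicProductChar (dualCoord b i) ((integralBasis K).repr k i) := by
  rw [adelicPairing, adelicChar, adelicTrace_fst_eq_zero _ _ b.2.1, realChar_zero, one_mul]
  simp_rw [padicProductChar_apply]
  rw [← finprod_prod_comm _ _ fun i _ => hasFiniteMulSupport_padicChar _ _]
  refine finprod_congr fun p => ?_
  rw [adelicTrace_algebraMap_mul, ← padicChar_sum,
    algebraMap_localProduct_eq_sum_repr (integralBasis K), Finset.sum_mul, map_sum]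
  simp_rw [smul_mul_assoc, map_smul, smul_eq_mul]
  rfl

/-- The character of `K` defined by an element of the adelic inverse different. -/
noncomputable def pairingHom (b : adelicInverseDifferent K) : K →+ Additive Circle where
  toFun k := Additive.ofMul (adelicPairing K (algebraMap K (AdeleRing (𝓞 K) K) k) b)
  map_zero' := by
    rw [adelicPairing_algebraMap]
    simp
  map_add' k l := by
    rw [adelicPairing_algebraMap, adelicPairing_algebraMap, adelicPairing_algebraMap, ← ofMul_mul,
      ← Finset.prod_mul_distrib]
    simp_rw [map_add, Finsupp.add_apply, AddChar.map_add_eq_mul]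

theorem pairingHom_apply (b : adelicInverseDifferent K) (k : K) : pairingHom b k =
    Additive.ofMul (adelicPairing K (algebraMap K (AdeleRing (𝓞 K) K) k) b) := rfl

theorem pairingHom_integer (b : adelicInverseDifferent K) (x : 𝓞 K) :
    pairingHom b (algebraMap (𝓞 K) K x) = 0 := by
  rw [pairingHom_apply, adelicPairing_algebraMap]
  simp_rw [integralBasis_repr_apply]
  refine congrArg Additive.ofMul (Finset.prod_eq_one fun i _ => ?_)
  exact padicProductChar_intCast _ _

/-- The character of `K / 𝓞` defined by an element of the adelic inverse different. -/
noncomputable def pairingChar (b : adelicInverseDifferent K) :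
    PontryaginDual (Multiplicative (FieldModIntegers K)) :=
  (⟨AddMonoidHom.toMultiplicativeLeft (QuotientAddGroup.lift (integersAddSubgroup K) (pairingHom b)
      (by rintro _ ⟨x, rfl⟩; exact pairingHom_integer b x) : FieldModIntegers K →+ Additive Circle),
    continuous_of_discreteTopology⟩ : Multiplicative (FieldModIntegers K) →ₜ* Circle)

theorem pairingChar_apply (b : adelicInverseDifferent K) (k : K) :
    pairingChar b (Multiplicative.ofAdd (toFieldModIntegers k)) =
      adelicPairing K (algebraMap K (AdeleRing (𝓞 K) K) k) b := rfl

theorem toFieldModIntegers_surjective {F : Type*} [Field F] :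
    Function.Surjective (toFieldModIntegers : F → FieldModIntegers F) :=
  QuotientAddGroup.mk_surjective

theorem pontryaginDual_ext {F : Type*} [Field F]
    {χ ψ : PontryaginDual (Multiplicative (FieldModIntegers F))}
    (h : ∀ k : F, χ (Multiplicative.ofAdd (toFieldModIntegers k)) =
      ψ (Multiplicative.ofAdd (toFieldModIntegers k))) : χ = ψ := by
  refine PontryaginDual.ext fun a => ?_
  obtain ⟨k, hk⟩ := toFieldModIntegers_surjective a.toAdd
  have := h k
  rwa [hk, ofAdd_toAdd] at this

theorem pairingChar_add (b b' : adelicInverseDifferent K) :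
    pairingChar (b + b') = pairingChar b * pairingChar b' := by
  refine pontryaginDual_ext fun k => ?_
  change _ = pairingChar b _ * pairingChar b' _
  simp_rw [pairingChar_apply, adelicPairing_algebraMap, dualCoord_add, Pi.add_apply,
    padicProductChar_add, Finset.prod_mul_distrib]

theorem pairingChar_smul_integralBasis (b : adelicInverseDifferent K) (q : ℚ) (i : BasisIndex K) :
    pairingChar b (Multiplicative.ofAdd (toFieldModIntegers (q • integralBasis K i))) =
      padicProductChar (dualCoord b i) q := by
  classical
  rw [pairingChar_apply, adelicPairing_algebraMap, Finset.prod_eq_single i]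
  · simp
  · intro j _ hj
    simp [Finsupp.single_eq_of_ne hj]
  · simp

theorem continuous_pairingChar : Continuous (pairingChar (K := K)) := by
  refine ContinuousMonoidHom.continuous_of_continuous_uncurry _ ?_
  -- Since `K / 𝓞` is discrete, joint continuity reduces to continuity in `b` for each fixed class.
  refine continuous_prod_of_discrete_right.2 fun a => ?_
  obtain ⟨k, hk⟩ := toFieldModIntegers_surjective a.toAdd
  obtain rfl : Multiplicative.ofAdd (toFieldModIntegers k) = a := by rw [hk, ofAdd_toAdd]
  change Continuous fun b : adelicInverseDifferent K => pairingChar b _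
  simp_rw [pairingChar_apply, adelicPairing_algebraMap]
  refine continuous_finsetProd _ fun i _ => (continuous_padicProductChar _).comp ?_
  exact continuous_pi fun p => continuous_dualCoord i p

/-- Restriction of a character of `K / 𝓞` to the line spanned by a vector of `K`. -/
noncomputable def lineChar (χ : PontryaginDual (Multiplicative (FieldModIntegers K))) (x : K) :
    AddChar ℚ Circle where
  toFun q := χ (Multiplicative.ofAdd (toFieldModIntegers (q • x)))
  map_zero_eq_one' := by
    rw [zero_smul]
    exact map_one χ
  map_add_eq_mul' q r := by
    rw [add_smul]
    exact map_mul χ (Multiplicative.ofAdd (toFieldModIntegers (q • x)))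
      (Multiplicative.ofAdd (toFieldModIntegers (r • x)))

theorem lineChar_integer (χ : PontryaginDual (Multiplicative (FieldModIntegers K))) (x : 𝓞 K) :
    lineChar χ (algebraMap (𝓞 K) K x) 1 = 1 := by
  have h : toFieldModIntegers (algebraMap (𝓞 K) K x) = 0 :=
    (QuotientAddGroup.eq_zero_iff _).2 ⟨x, rfl⟩
  change χ (Multiplicative.ofAdd (toFieldModIntegers ((1 : ℚ) • algebraMap (𝓞 K) K x))) = 1
  rw [one_smul, h]
  exact map_one χ

theorem eq_of_lineChar_integralBasis_eq {χ ψ : PontryaginDual (Multiplicative (FieldModIntegers K))}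
    (h : ∀ i, lineChar χ (integralBasis K i) = lineChar ψ (integralBasis K i)) : χ = ψ := by
  refine pontryaginDual_ext fun k => ?_
  have hsum (φ : PontryaginDual (Multiplicative (FieldModIntegers K))) :
      φ (Multiplicative.ofAdd (toFieldModIntegers k)) =
        ∏ i, lineChar φ (integralBasis K i) ((integralBasis K).repr k i) := by
    let g : K →+ Additive Circle :=
      { toFun := fun k => Additive.ofMul (φ (Multiplicative.ofAdd (toFieldModIntegers k)))
        map_zero' := map_one φ
        map_add' := fun k l => map_mul φ (Multiplicative.ofAdd (toFieldModIntegers k))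
          (Multiplicative.ofAdd (toFieldModIntegers l)) }
    change g k = Additive.ofMul _
    conv_lhs => rw [← (integralBasis K).sum_repr k, map_sum]
    rfl
  rw [hsum, hsum]
  simp_rw [h]

/-- On the line `ℚ ω_i`, the character of `b` is the character of `ℚ / ℤ` attached to the `i`-th
coordinate of `b`. Both injectivity and surjectivity follow line by line from the duality of `ℚ / ℤ`
with `∏_p ℤ_p`. -/
theorem pairingChar_bijective : Function.Bijective (pairingChar (K := K)) := by
  constructor
  · intro b b' h
    refine sub_eq_zero.1 (dualCoord_injective (K := K) (a₂ := 0) ?_)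
    have h1 : pairingChar (b - b') = 1 := by
      rw [← mul_left_inj (pairingChar b'), ← pairingChar_add, sub_add_cancel, h, one_mul]
    have h2 : dualCoord (0 : adelicInverseDifferent K) = 0 := by
      simpa using dualCoord_add (0 : adelicInverseDifferent K) 0
    rw [h2]
    funext i
    refine padicProductChar_injective fun q => ?_
    rw [← pairingChar_smul_integralBasis, h1]
    rfl
  · intro χ
    have h1 (i) : lineChar χ (integralBasis K i) 1 = 1 := by
      rw [integralBasis_apply]
      exact lineChar_integer χ _
    choose c hc using fun i => exists_padicProductChar_eq _ (h1 i)
    obtain ⟨σ, -, hσ⟩ := exists_continuous_dualCoord_eq K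
    refine ⟨σ c, eq_of_lineChar_integralBasis_eq fun i => ?_⟩
    rw [← hc]
    ext1 q
    rw [← congrFun (hσ c) i]
    exact pairingChar_smul_integralBasis _ q i

variable (K) in
/-- The adelic inverse different is the Pontryagin dual of `K / 𝓞`. -/
noncomputable def inverseDifferentEquivDual : Multiplicative (adelicInverseDifferent K) ≃ₜ*
    PontryaginDual (Multiplicative (FieldModIntegers K)) :=
  let e : Multiplicative (adelicInverseDifferent K) ≃
      PontryaginDual (Multiplicative (FieldModIntegers K)) :=
    Multiplicative.toAdd.trans (Equiv.ofBijective _ pairingChar_bijective)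
  have he : Continuous e := continuous_pairingChar.comp continuous_toAdd
  { e with
    map_mul' := fun b b' => pairingChar_add b.toAdd b'.toAdd
    continuous_toFun := he
    -- A continuous bijection from a compact space to a Hausdorff space has a continuous inverse.
    continuous_invFun := (he.homeoOfEquivCompactToT2 (f := e)).symm.continuous }

end AdelicDuality

theorem mainTheorem11 (K : Type*) [Field K] [NumberField K] :
    (∃ ι : (∀ v : HeightOneSpectrum (𝓞 K), AdelicDuality.localInverseDifferent v) ≃ₜ+
        AdelicDuality.adelicInverseDifferent K,
      ∀ d, (ι d : AdeleRing (𝓞 K) K).1 = 0 ∧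
        ∀ v : HeightOneSpectrum (𝓞 K), (ι d : AdeleRing (𝓞 K) K).2 v = d v) ∧
    ∃ Φ : PontryaginDual (Multiplicative (AdelicDuality.FieldModIntegers K)) ≃ₜ*
        Multiplicative (AdelicDuality.adelicInverseDifferent K),
      ∀ (χ : PontryaginDual (Multiplicative (AdelicDuality.FieldModIntegers K))) (k : K),
        χ (Multiplicative.ofAdd (AdelicDuality.toFieldModIntegers k)) =
          AdelicDuality.adelicPairing K (algebraMap K (AdeleRing (𝓞 K) K) k)
            ((Φ χ).toAdd : AdeleRing (𝓞 K) K) := by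
  refine ⟨AdelicDuality.exists_inverseDifferent_continuousAddEquiv K,
    (AdelicDuality.inverseDifferentEquivDual K).symm, fun χ k => ?_⟩
  obtain ⟨b, rfl⟩ := (AdelicDuality.inverseDifferentEquivDual K).surjective χ
  rw [ContinuousMulEquiv.symm_apply_apply]
  exact AdelicDuality.pairingChar_apply b.toAdd k
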